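/- **Sketches.** A sketch $A$ has a countable state space $\mathcal M$ and an induced distribution family $\psi_\lambda$ ($\lambda>0$), where $\psi_\lambda(x)$ is the probability of being in state $x\in\mathcal M$ at (Poissonized) cardinality $\lambda$. Write $$H_A(\lambda)=\sum_{x}-\psi_\lambda(x)\log_2\psi_\lambda(x),\qquad I_A(\lambda)=\sum_{x:\,\psi_\lambda(x)>0}\Big(\frac{\frac{d}{d\lambda}\psi_\lambda(x)}{\psi_\lambda(x)}\Big)^2\psi_\lambda(x)$$ for the Shannon entropy of the state and the Fisher information of $\lambda$ with respect to the state; both lie in $[0,\infty]$ (a derivative that does not exist is read as $0$). For $q>1$, $A$ is *weakly scale-invariant with base $q$* if $H_A(\lambda)=H_A(q\lambda)$ and $I_A(\lambda)=q^2I_A(q\lambda)$ for all $\lambda>0$. Its *Fish number* is then $$\mathsf{Fish}(A)=\frac{\mathcal H(A)}{\mathcal I(A)},\qquad \mathcal H(A)=\int_0^1H_A(q^r)\,dr,\qquad \mathcal I(A)=\int_0^1q^{2r}I_A(q^r)\,dr,$$ an element of $[0,\infty]$, which is well defined unless the quotient reads $0/0$ or $\infty/\infty$. **Linearizable sketches.**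 Consider a countable, linearly ordered set $\mathcal C$ of cells with sizes $p_c\ge 0$. At time $\lambda$ the numbers of darts in the cells are independent Poisson variables with means $p_c\lambda$; let $Z_c\in\{0,1\}$ indicate that $c$ contains a dart. For each $c$ let $\phi_c$ be a monotone $\{0,1\}$-valued function of the set of occupied cells preceding $c$. The set of occupied cells, with indicators $Y_c$, is given by $$Y_c=Z_c\vee\phi_c\big((Y_{c'})_{c'<c}\big)\qquad(c\in\mathcal C);$$ if the order of the cells is not a well-order, so that this recursion may have several solutions, $Y$ is its least solution. The map from dart counts to $Y$ is assumed measurable. A sketch is *linearizable* if, for some such data, its states can be identified injectively with sets of occupied cells in such a way that $\psi_\lambda$ is the distribution of $Y$ at time $\lambda$, for every $\lambda>0$. (The total size of the cells may be infinite: a sketch that is exactly scale-invariant and not constant needs infinitely many arbitrarily large and arbitrarily small cells.) **Statement.** Let $h(x)=-x\ln x-(1-x)\ln(1-x)$ and $$H_0=\frac1{\ln 2}\int_{-\infty}^{\infty}h\big(e^{-e^w}\big)\,dw,\qquad I_0=\int_{-\infty}^{\infty}\frac{e^{2w}}{e^{e^w}-1}\,dw .$$ Let $q>1$ and let $A$ be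 a linearizable sketch that is weakly scale-invariant with base $q$ and whose Fish number is well defined, i.e. $\mathcal H(A),\mathcal I(A)$ are neither both $0$ nor both $\infty$. Then $$\mathsf{Fish}(A)\ \ge\ \frac{H_0}{I_0}.$$ -/

import Mathlib

open MeasureTheory ProbabilityTheory
open scoped ENNReal NNReal

noncomputable section

/-! ### Sketches as parameterized families of distributions -/

/-- The induced distribution family of a sketch with state space `M`: `prob t x` is the probability
that the sketch is in state `x` at cardinality `t > 0`.  (Values at `t ≤ 0` are irrelevant.) -/
structure SketchIDF (M : Type*) where
  prob : ℝ → M → ℝ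
  prob_nonneg : ∀ t, 0 < t → ∀ x, 0 ≤ prob t x
  prob_hasSum : ∀ t, 0 < t → HasSum (prob t) 1

namespace SketchIDF

variable {M : Type*}

/-- Shannon entropy, in bits, of the state at cardinality `t`. -/
def entropy (A : SketchIDF M) (t : ℝ) : ℝ≥0∞ :=
  ∑' x, ENNReal.ofReal (-(A.prob t x) * Real.logb 2 (A.prob t x))

/-- Fisher information of the cardinality with respect to the state, at cardinality `t`: the
expected square of the logarithmic derivative of the probability.  States of probability zero
contribute nothing to the expectation. -/
def fisherInfo (A : SketchIDF M) (t : ℝ) : ℝ≥0∞ :=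
  ∑' x, ENNReal.ofReal ((deriv (fun s => A.prob s x) t / A.prob t x) ^ 2 * A.prob t x)

/-- Weak scale-invariance with base `q`. -/
def WeaklyScaleInvariant (A : SketchIDF M) (q : ℝ) : Prop :=
  1 < q ∧ ∀ t : ℝ, 0 < t →
    A.entropy t = A.entropy (q * t) ∧
    A.fisherInfo t = ENNReal.ofReal (q ^ 2) * A.fisherInfo (q * t)

/-- Entropy averaged over one multiplicative period. -/
def avgEntropy (A : SketchIDF M) (q : ℝ) : ℝ≥0∞ :=
  ∫⁻ r in Set.Icc (0 : ℝ) 1, A.entropy (q ^ r)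

/-- Normalized Fisher information averaged over one multiplicative period. -/
def avgInfo (A : SketchIDF M) (q : ℝ) : ℝ≥0∞ :=
  ∫⁻ r in Set.Icc (0 : ℝ) 1, ENNReal.ofReal (q ^ (2 * r)) * A.fisherInfo (q ^ r)

/-- The Fisher–Shannon number of a sketch that is weakly scale-invariant with base `q`.
It is meaningful unless the quotient reads `0 / 0` or `∞ / ∞`. -/
def fish (A : SketchIDF M) (q : ℝ) : ℝ≥0∞ :=
  A.avgEntropy q / A.avgInfo q

end SketchIDF

/-! ### The Poissonized dartboard and linearizable sketches -/

/-- A dartboard with a linearly ordered set `C` of cells, and a linear update rule on it.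
`size c` is the rate at which darts hit `c`.  `force c σ` is the monotone function `φ` of the
occupied cells preceding `c`; it is only ever evaluated at subsets of `Set.Iio c`.
If it is true, then `c` is occupied whether or not it has been hit. -/
structure LinearRule (C : Type*) [LinearOrder C] where
  size : C → ℝ≥0
  force : C → Set C → Prop
  force_mono : ∀ c σ τ, σ ⊆ τ → force c σ → force c τ

namespace LinearRule

variable {C : Type*} [LinearOrder C]

/-- The cells that are hit, or forced by the cells of `σ` preceding them. -/
def step (R : LinearRule C) (hit : Set C) : Set C →o Set C where
  toFun σ := hit ∪ {c | R.force c (σ ∩ Set.Iio c)}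
  monotone' _ _ h := Set.union_subset_union_right _ fun c hc =>
    R.force_mono c _ _ (Set.inter_subset_inter_left _ h) hc

/-- The set of occupied cells once the cells of `hit` have been hit: the least `σ` such that a cell
belongs to `σ` iff it is hit, or forced by the cells of `σ` preceding it.  (Leastness matters only
if the order of the cells is not a well-order, see `eq_state`: no cell is occupied without cause.) -/
def state (R : LinearRule C) (hit : Set C) : Set C :=
  OrderHom.lfp (R.step hit)

/-- The defining recursion `Yᵢ = Zᵢ ∨ φ(Y₀, …, Yᵢ₋₁)`. -/
theorem mem_state_iff (R : LinearRule C) (hit : Set C) (c : C) :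
    c ∈ R.state hit ↔ c ∈ hit ∨ R.force c (R.state hit ∩ Set.Iio c) := by
  have h : R.step hit (R.state hit) = R.state hit := OrderHom.map_lfp _
  exact (Set.ext_iff.1 h c).symm

/-- For well-ordered cells the recursion alone determines the state. -/
theorem eq_state [WellFoundedLT C] (R : LinearRule C) (hit σ : Set C)
    (h : ∀ c, c ∈ σ ↔ c ∈ hit ∨ R.force c (σ ∩ Set.Iio c)) : σ = R.state hit := by
  ext c
  induction c using WellFoundedLT.induction with
  | ind c ih =>
    have e : σ ∩ Set.Iio c = R.state hit ∩ Set.Iio c := by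
      ext d
      exact and_congr_left fun hd => ih d hd
    rw [h, R.mem_state_iff, e]

/-- The joint law, at time `t`, of the numbers of darts in the cells: independent Poisson variables
with means `size c * t`. -/
def dartLaw (R : LinearRule C) (t : ℝ) : Measure (C → ℕ) :=
  Measure.infinitePi fun c => poissonMeasure (R.size c * t.toNNReal)

/-- The state of the sketch as a function of the numbers of darts in the cells. -/
def stateOf (R : LinearRule C) (darts : C → ℕ) : Set C :=
  R.state {c | darts c ≠ 0}

end LinearRule

/-- A sketch is linearizable if its states can be identified with sets of occupied cells of a
dartboard with countably many linearly ordered cells, such that the random set of occupied cells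
is produced by a linear rule from the darts thrown up to time `t`. -/
def SketchIDF.Linearizable {M : Type*} (A : SketchIDF M) : Prop :=
  ∃ (C : Type) (_ : Countable C) (_ : LinearOrder C) (R : LinearRule C) (occ : M → Set C),
    Function.Injective occ ∧ Measurable R.stateOf ∧
    ∀ t : ℝ, 0 < t → ∀ x, A.prob t x = (R.dartLaw t).real {darts | R.stateOf darts = occ x}

/-! ### The constants -/

/-- Entropy in nats of a Bernoulli variable. -/
def bernoulliEntropy (x : ℝ) : ℝ := -x * Real.log x - (1 - x) * Real.log (1 - x)

/-- The constant `H₀`. -/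
def constH0 : ℝ := 1 / Real.log 2 * ∫ w : ℝ, bernoulliEntropy (Real.exp (-Real.exp w))

/-- The constant `I₀`. -/
def constI0 : ℝ := ∫ w : ℝ, Real.exp w ^ 2 / (Real.exp (Real.exp w) - 1)

end

/-
A cell that is not forced by the cells before it reveals a fresh Poisson indicator, so the chain
rule writes entropy and information as sums over the cells, weighted by the probability `freeProb`
of not being forced, of the entropy `cellEntropy` and the (logarithmic) information `cellInfo` of
an indicator. Without a well-order the chain rule is replaced by the inequalities that are needed:
the probability of a state is at most every finite product of cell probabilities, and it is their
limit unless it vanishes (by a zero-one law), so that its score is the limit of sums of orthogonal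
cell scores.

The ratio `cellEntropy / cellInfo` decreases in the size of the cell, and `freeProb` decreases in
time. Chebyshev's association inequality, with time on a logarithmic scale, therefore shows that
forcing can only increase the ratio of entropy to information above `H₀ / I₀`. Integrals over one
period are recovered from integrals over a half-line by damping with a density `b ^ r` and letting
`b` decrease to `1`.
-/

open Filter Topology

namespace LinearRule

section Deterministic

variable {C : Type*} [LinearOrder C] (R : LinearRule C)

theorem state_subset {hit σ : Set C} (h1 : hit ⊆ σ)
    (h2 : ∀ c, R.force c (σ ∩ Set.Iio c) → c ∈ σ) : R.state hit ⊆ σ :=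
  OrderHom.lfp_le _ (Set.union_subset h1 h2)

theorem subset_state (hit : Set C) : hit ⊆ R.state hit :=
  fun c hc => (R.mem_state_iff hit c).2 (Or.inl hc)

theorem mem_state_of_force {hit : Set C} {c : C} (h : R.force c (R.state hit ∩ Set.Iio c)) :
    c ∈ R.state hit :=
  (R.mem_state_iff hit c).2 (Or.inr h)

theorem state_subset_state {hit hit' : Set C} (h : hit ⊆ R.state hit') :
    R.state hit ⊆ R.state hit' :=
  R.state_subset h fun _ => R.mem_state_of_force

theorem state_mono : Monotone R.state :=
  fun _ hit' h => R.state_subset_state (h.trans (R.subset_state hit'))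

theorem state_eq_of_subset_of_subset_state {hit hit' : Set C} (h : hit ⊆ hit')
    (h' : hit' ⊆ R.state hit) : R.state hit' = R.state hit :=
  (R.state_subset_state h').antisymm (R.state_mono h)

theorem state_inter_Iio (hit : Set C) (c : C) :
    R.state (hit ∩ Set.Iio c) ∩ Set.Iio c = R.state hit ∩ Set.Iio c := by
  refine (Set.inter_subset_inter_left _ (R.state_mono Set.inter_subset_left)).antisymm ?_
  suffices h : R.state hit ⊆ R.state (hit ∩ Set.Iio c) ∪ Set.Ici c from
    fun d hd => ⟨(h hd.1).resolve_right (not_le.2 hd.2), hd.2⟩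
  apply R.state_subset
  · intro d hd
    rcases lt_or_ge d c with hdc | hcd
    · exact Or.inl (R.subset_state _ ⟨hd, hdc⟩)
    · exact Or.inr hcd
  · intro d hd
    rcases lt_or_ge d c with hdc | hcd
    · refine Or.inl (R.mem_state_of_force (R.force_mono _ _ _ ?_ hd))
      exact fun e he => ⟨he.1.resolve_right (not_le.2 (he.2.trans hdc)), he.2⟩
    · exact Or.inr hcd

theorem force_iff_mem_state_sdiff (hit : Set C) (c : C) :
    R.force c (R.state hit ∩ Set.Iio c) ↔ c ∈ R.state (hit \ {c}) := by
  have e : (hit \ {c}) ∩ Set.Iio c = hit ∩ Set.Iio c := by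
    ext d
    have : d < c → d ≠ c := ne_of_lt
    simp only [Set.mem_inter_iff, Set.mem_sdiff, Set.mem_singleton_iff, Set.mem_Iio]
    tauto
  rw [R.mem_state_iff, ← R.state_inter_Iio (hit \ {c}), e, R.state_inter_Iio]
  simp

theorem state_eq_of_finite_sdiff {hit hit' : Set C} (hsub : hit' ⊆ hit)
    (hfin : (hit \ hit').Finite)
    (hforce : ∀ c ∈ hit \ hit', R.force c (R.state hit ∩ Set.Iio c)) :
    R.state hit' = R.state hit := by
  refine (R.state_mono hsub).antisymm (R.state_subset_state ?_)
  by_contra hne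
  obtain ⟨a, ⟨haH, haS⟩, hmin⟩ := Set.exists_min_image (hit \ R.state hit') id
    (hfin.subset (Set.sdiff_subset_sdiff_right (R.subset_state hit')))
    (Set.nonempty_of_not_subset hne)
  have hbefore : hit ∩ Set.Iio a ⊆ R.state hit' := fun d hd => by
    by_contra hdS
    exact not_lt.2 (hmin d ⟨hd.1, hdS⟩) hd.2
  refine haS (R.mem_state_of_force (R.force_mono a _ _ ?_
    (hforce a ⟨haH, fun h => haS (R.subset_state hit' h)⟩)))
  rw [← R.state_inter_Iio]
  exact Set.inter_subset_inter_left _ (R.state_subset_state hbefore)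

/-- The cells of `σ` that are not forced by the preceding cells of `σ`: these must have been hit
in order to reach the state `σ`. -/
def essential (σ : Set C) : Set C := {c | c ∈ σ ∧ ¬ R.force c (σ ∩ Set.Iio c)}

theorem essential_subset (σ : Set C) : R.essential σ ⊆ σ := fun _ h => h.1

theorem state_eq_iff (hit σ : Set C) :
    R.state hit = σ ↔
      (R.essential σ ⊆ hit ∧ hit ⊆ σ) ∧ R.state (R.essential σ ∪ σ ∩ hit) = σ := by
  have key : R.essential σ ⊆ hit → hit ⊆ σ → R.essential σ ∪ σ ∩ hit = hit := fun h1 h2 => by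
    rw [Set.inter_eq_right.2 h2, Set.union_eq_right.2 h1]
  constructor
  · rintro rfl
    have h1 : R.essential (R.state hit) ⊆ hit := fun c hc =>
      ((R.mem_state_iff hit c).1 hc.1).resolve_right hc.2
    exact ⟨⟨h1, R.subset_state hit⟩, by rw [key h1 (R.subset_state hit)]⟩
  · rintro ⟨⟨h1, h2⟩, h⟩
    rwa [key h1 h2] at h

theorem state_essential_union_eq_iff_of_finite (hit σ : Set C) {F : Set C} (hF : F.Finite) :
    R.state (R.essential σ ∪ σ ∩ (hit \ F)) = σ ↔ R.state (R.essential σ ∪ σ ∩ hit) = σ := by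
  have hsub : R.essential σ ∪ σ ∩ (hit \ F) ⊆ R.essential σ ∪ σ ∩ hit := by
    gcongr
    exact Set.sdiff_subset
  have hdiff : (R.essential σ ∪ σ ∩ hit) \ (R.essential σ ∪ σ ∩ (hit \ F)) ⊆
      F ∩ (σ \ R.essential σ) := by
    intro c
    simp only [Set.mem_sdiff, Set.mem_union, Set.mem_inter_iff]
    tauto
  constructor <;> intro h
  · rw [R.state_eq_of_subset_of_subset_state hsub, h]
    exact (Set.union_subset (R.essential_subset σ) Set.inter_subset_left).trans h.ge
  · rw [R.state_eq_of_finite_sdiff hsub (hF.subset (hdiff.trans Set.inter_subset_left)), h]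
    intro c hc
    rw [h]
    have hcσ := (hdiff hc).2
    exact not_not.1 fun hf => hcσ.2 ⟨hcσ.1, hf⟩

end Deterministic

end LinearRule

section ProductMeasure

variable {ι E : Type*} [MeasurableSpace E]

theorem measurable_indicator_cylinderEvents [Zero E] (S : Set ι) :
    Measurable[cylinderEvents S] fun ω : ι → E => S.indicator ω := by
  classical
  refine @measurable_pi_lambda _ _ _ (cylinderEvents S) _ _ fun i => ?_
  by_cases hi : i ∈ S
  · simpa [hi] using measurable_cylinderEvent_apply hi
  · simp [hi]

theorem indep_cylinderEvents_infinitePi (μ : ι → Measure E) [∀ i, IsProbabilityMeasure (μ i)]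
    {S T : Set ι} (hST : Disjoint S T) :
    Indep (cylinderEvents S) (cylinderEvents T) (Measure.infinitePi μ) :=
  indep_iSup_of_disjoint (fun i => (measurable_pi_apply i).comap_le)
    (iIndepFun_infinitePi (X := fun _ x => x) fun _ => measurable_id) hST

theorem indepFun_eval_infinitePi [Zero E] (μ : ι → Measure E) [∀ i, IsProbabilityMeasure (μ i)]
    {β : Type*} [MeasurableSpace β] {X : (ι → E) → β} (hX : Measurable X) {S : Set ι}
    (hXS : ∀ ω, X (S.indicator ω) = X ω) {i : ι} (hi : i ∉ S) :
    IndepFun X (fun ω => ω i) (Measure.infinitePi μ) := by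
  have hXm : Measurable[cylinderEvents S] X := by
    simpa only [Function.comp_def, hXS] using hX.comp (measurable_indicator_cylinderEvents S)
  exact indep_of_indep_of_le_left (indep_of_indep_of_le_right
    (indep_cylinderEvents_infinitePi μ (Set.disjoint_singleton_right.2 hi))
    (measurable_cylinderEvent_apply (Set.mem_singleton i)).comap_le) hXm.comap_le

theorem infinitePi_eq_zero_or_one [Zero E] (μ : ι → Measure E)
    [∀ i, IsProbabilityMeasure (μ i)] {W : Set (ι → E)} (hW : MeasurableSet W)
    (htail : ∀ F : Set ι, F.Finite → ∀ ω, Fᶜ.indicator ω ∈ W ↔ ω ∈ W) :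
    Measure.infinitePi μ W = 0 ∨ Measure.infinitePi μ W = 1 := by
  refine measure_zero_or_one_of_measurableSet_limsup (f := cofinite) (p := Set.Finite)
    (ns := fun F : Finset ι => (F : Set ι)) (fun i => (measurable_pi_apply i).comap_le)
    (iIndepFun_infinitePi (X := fun _ x => x) fun _ => measurable_id)
    (fun s hs => hs.compl_mem_cofinite) ?_ Finset.finite_toSet (fun i => ⟨{i}, by simp⟩) ?_
  · classical
    exact directed_of_isDirected_le fun _ _ h => Finset.coe_subset.2 h
  · rw [limsup_eq, MeasurableSpace.measurableSet_sInf]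
    intro m hm
    set S : Set ι := {i | MeasurableSpace.comap (fun ω : ι → E => ω i) inferInstance ≤ m}
    have hWS : MeasurableSet[cylinderEvents S] W := by
      have h := measurable_indicator_cylinderEvents (E := E) S hW
      rwa [show (fun ω => S.indicator ω) ⁻¹' W = W from
        Set.ext fun ω => by simpa using htail Sᶜ hm ω] at h
    have hSm : cylinderEvents (X := fun _ => E) S ≤ m := iSup₂_le fun i hi => hi
    exact hSm W hWS

end ProductMeasure

theorem poissonMeasure_real_zero (r : ℝ≥0) : (poissonMeasure r).real {0} = Real.exp (-r) := by
  rw [poissonMeasure_real_singleton]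
  simp

theorem integral_ite_poissonMeasure (r : ℝ≥0) (a b : ℝ) :
    ∫ n : ℕ, (if n = 0 then a else b) ∂poissonMeasure r =
      Real.exp (-r) * a + (1 - Real.exp (-r)) * b := by
  have e : (fun n : ℕ => if n = 0 then a else b) =
      fun n => b + ({0} : Set ℕ).indicator (fun _ => a - b) n := by
    funext n
    by_cases h : n = 0 <;> simp [h]
  rw [e, integral_add (integrable_const _)
    ((integrable_const _).indicator (measurableSet_singleton 0)),
    integral_indicator_const _ (measurableSet_singleton 0), poissonMeasure_real_zero]
  simp
  ring

namespace LinearRule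

section Probability

variable {C : Type*} [LinearOrder C] (R : LinearRule C)

instance (t : ℝ) : IsProbabilityMeasure (R.dartLaw t) := by
  unfold dartLaw
  infer_instance

open Classical in
/-- The factor contributed by the cell `c` to a product over the cells of the state `σ`: `a` if the
cell is empty, `e` if it is forced, and `b` if it is occupied without being forced. -/
noncomputable def cellVal {α : Type*} (a b e : α) (c : C) (σ : Set C) : α :=
  if c ∈ σ then (if R.force c (σ ∩ Set.Iio c) then e else b) else a

theorem apply_cellVal {α β : Type*} (f : α → β) (a b e : α) (c : C) (σ : Set C) :
    f (R.cellVal a b e c σ) = R.cellVal (f a) (f b) (f e) c σ := by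
  unfold cellVal
  split_ifs <;> rfl

/-- The numbers of darts that can occur in the cell `c` when the state is `σ`. -/
noncomputable def dartBox (σ : Set C) (c : C) : Set ℕ := R.cellVal {0} {0}ᶜ Set.univ c σ

theorem mem_pi_dartBox_iff (σ : Set C) (ω : C → ℕ) :
    ω ∈ Set.univ.pi (R.dartBox σ) ↔
      R.essential σ ⊆ Function.support ω ∧ Function.support ω ⊆ σ := by
  have hbox : ∀ c, ω c ∈ R.dartBox σ c ↔
      (c ∈ R.essential σ → ω c ≠ 0) ∧ (ω c ≠ 0 → c ∈ σ) := fun c => by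
    unfold dartBox cellVal essential
    split_ifs <;> simp_all
  simp only [Set.mem_univ_pi, hbox, forall_and, Set.subset_def, Function.mem_support]

/-- The event that the cells of `σ` that are hit, together with the essential cells of `σ`, lead to
the state `σ`. Unlike the event that the state is `σ`, it is a tail event. -/
def completionEvent (σ : Set C) : Set (C → ℕ) :=
  {ω | R.state (R.essential σ ∪ σ ∩ Function.support ω) = σ}

theorem setOf_stateOf_eq (σ : Set C) :
    {ω | R.stateOf ω = σ} = Set.univ.pi (R.dartBox σ) ∩ R.completionEvent σ := by
  ext ω
  rw [Set.mem_inter_iff, mem_pi_dartBox_iff]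
  exact R.state_eq_iff _ _

/-- The probability that the number of darts in the cell `c` is as required by the state `σ`. -/
noncomputable def cellProb (t : ℝ) (c : C) (σ : Set C) : ℝ :=
  R.cellVal (Real.exp (-(R.size c * t))) (1 - Real.exp (-(R.size c * t))) 1 c σ

theorem coe_size_mul_toNNReal {t : ℝ} (ht : 0 ≤ t) (c : C) :
    ((R.size c * t.toNNReal : ℝ≥0) : ℝ) = R.size c * t := by
  rw [NNReal.coe_mul, Real.coe_toNNReal _ ht]

theorem poissonMeasure_dartBox {t : ℝ} (ht : 0 ≤ t) (c : C) (σ : Set C) :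
    (poissonMeasure (R.size c * t.toNNReal)).real (R.dartBox σ c) = R.cellProb t c σ := by
  rw [dartBox, R.apply_cellVal (poissonMeasure (R.size c * t.toNNReal)).real,
    probReal_compl_eq_one_sub (measurableSet_singleton 0), poissonMeasure_real_zero,
    R.coe_size_mul_toNNReal ht, probReal_univ, cellProb]

theorem prob_le_prod_cellProb {t : ℝ} (ht : 0 ≤ t) (σ : Set C) (F : Finset C) :
    (R.dartLaw t).real {ω | R.stateOf ω = σ} ≤ ∏ c ∈ F, R.cellProb t c σ := by
  have h : (R.dartLaw t).real ((F : Set C).pi (R.dartBox σ)) = ∏ c ∈ F, R.cellProb t c σ := by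
    rw [measureReal_def, dartLaw, Measure.infinitePi_pi _ fun _ _ => MeasurableSet.of_discrete,
      ENNReal.toReal_prod]
    exact Finset.prod_congr rfl fun c _ => R.poissonMeasure_dartBox ht c σ
  rw [← h, setOf_stateOf_eq]
  exact measureReal_mono fun ω hω c _ => hω.1 c trivial

theorem tendsto_prod_cellProb [Countable C] {t : ℝ} (ht : 0 ≤ t) (σ : Set C) :
    Tendsto (fun F : Finset C => ∏ c ∈ F, R.cellProb t c σ) atTop
      (𝓝 ((R.dartLaw t).real (Set.univ.pi (R.dartBox σ)))) := by
  have hprod : Tendsto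
      (fun F : Finset C => ∏ c ∈ F, poissonMeasure (R.size c * t.toNNReal) (R.dartBox σ c))
      atTop (𝓝 (R.dartLaw t (Set.univ.pi (R.dartBox σ)))) := by
    rw [dartLaw, Measure.infinitePi_pi_univ _ fun _ => MeasurableSet.of_discrete,
      ENNReal.tprod_eq_iInf_prod fun _ => prob_le_one]
    exact tendsto_atTop_iInf (Finset.prod_anti_set_of_le_one' fun _ => prob_le_one)
  refine ((ENNReal.tendsto_toReal (measure_ne_top _ _)).comp hprod).congr fun F => ?_
  simp only [Function.comp, ENNReal.toReal_prod]
  exact Finset.prod_congr rfl fun c _ => R.poissonMeasure_dartBox ht c σ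

variable {R}

theorem measurableSet_stateOf_eq [Countable C] (hm : Measurable R.stateOf) (σ : Set C) :
    MeasurableSet {ω | R.stateOf ω = σ} := by
  have e : {ω | R.stateOf ω = σ} = ⋂ c, {ω | c ∈ R.stateOf ω ↔ c ∈ σ} := by
    ext ω
    simp [Set.ext_iff]
  rw [e]
  exact MeasurableSet.iInter fun c =>
    (((measurable_set_mem c).comp hm).iff measurable_const).setOf

theorem measurableSet_completionEvent [Countable C] (hm : Measurable R.stateOf) (σ : Set C) :
    MeasurableSet (R.completionEvent σ) := by
  classical
  set Φ : (C → ℕ) → C → ℕ := fun ω c =>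
    if c ∈ R.essential σ then 1 else if c ∈ σ then ω c else 0 with hΦ
  have hΦm : Measurable Φ := measurable_pi_lambda _ fun c => by
    simp only [hΦ]
    split_ifs
    exacts [measurable_const, measurable_pi_apply c, measurable_const]
  have hsupp : ∀ ω, Function.support (Φ ω) = R.essential σ ∪ σ ∩ Function.support ω := by
    intro ω
    ext c
    simp only [hΦ, Function.mem_support, Set.mem_union, Set.mem_inter_iff]
    split_ifs <;> simp_all
  simp only [completionEvent, ← hsupp]
  exact hΦm (measurableSet_stateOf_eq hm σ)

theorem dartLaw_completionEvent_eq_zero_or_one [Countable C] (hm : Measurable R.stateOf) (t : ℝ)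
    (σ : Set C) :
    R.dartLaw t (R.completionEvent σ) = 0 ∨ R.dartLaw t (R.completionEvent σ) = 1 := by
  refine infinitePi_eq_zero_or_one _ (measurableSet_completionEvent hm σ) fun F hF ω => ?_
  have h := R.state_essential_union_eq_iff_of_finite (Function.support ω) σ hF
  rw [Set.sdiff_eq, Set.inter_comm _ Fᶜ] at h
  simpa only [completionEvent, Set.mem_ofPred_eq, Set.support_indicator] using h

theorem prob_eq_of_ne_zero [Countable C] (hm : Measurable R.stateOf) {t : ℝ} {σ : Set C}
    (hpos : (R.dartLaw t).real {ω | R.stateOf ω = σ} ≠ 0) :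
    (R.dartLaw t).real {ω | R.stateOf ω = σ} =
      (R.dartLaw t).real (Set.univ.pi (R.dartBox σ)) := by
  rw [setOf_stateOf_eq] at hpos ⊢
  have hone : R.dartLaw t (R.completionEvent σ) = 1 := by
    refine (dartLaw_completionEvent_eq_zero_or_one hm t σ).resolve_left fun h => hpos ?_
    rw [measureReal_eq_zero_iff]
    exact measure_mono_null Set.inter_subset_right h
  exact congrArg ENNReal.toReal (measure_inter_conull
    ((prob_compl_eq_zero_iff (measurableSet_completionEvent hm σ)).2 hone))

theorem tendsto_prod_cellProb_prob [Countable C] (hm : Measurable R.stateOf) {t : ℝ} (ht : 0 ≤ t)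
    {σ : Set C} (hpos : (R.dartLaw t).real {ω | R.stateOf ω = σ} ≠ 0) :
    Tendsto (fun F : Finset C => ∏ c ∈ F, R.cellProb t c σ) atTop
      (𝓝 ((R.dartLaw t).real {ω | R.stateOf ω = σ})) := by
  rw [prob_eq_of_ne_zero hm hpos]
  exact R.tendsto_prod_cellProb ht σ

end Probability

end LinearRule

namespace LinearRule

section Forcing

variable {C : Type*} [LinearOrder C] (R : LinearRule C)

/-- The event that the cell `c` is not forced by the occupied cells preceding it. -/
def freeEvent (c : C) : Set (C → ℕ) := {ω | ¬ R.force c (R.stateOf ω ∩ Set.Iio c)}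

/-- The probability that the cell `c` is not forced at time `t`. -/
noncomputable def freeProb (c : C) (t : ℝ) : ℝ := (R.dartLaw t).real (R.freeEvent c)

theorem freeProb_nonneg (c : C) (t : ℝ) : 0 ≤ R.freeProb c t := measureReal_nonneg

theorem stateOf_indicator_Iio_inter (ω : C → ℕ) (c : C) :
    R.stateOf ((Set.Iio c).indicator ω) ∩ Set.Iio c = R.stateOf ω ∩ Set.Iio c := by
  have h := R.state_inter_Iio (Function.support ω) c
  rwa [Set.inter_comm (Function.support ω), ← Set.support_indicator] at h

theorem indicator_Iio_mem_freeEvent (ω : C → ℕ) (c : C) :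
    (Set.Iio c).indicator ω ∈ R.freeEvent c ↔ ω ∈ R.freeEvent c := by
  simp only [freeEvent, Set.mem_ofPred_eq, stateOf_indicator_Iio_inter]

theorem cellVal_stateOf (a b : ℝ) (c : C) (ω : C → ℕ) :
    R.cellVal a b 0 c (R.stateOf ω) =
      (R.freeEvent c).indicator (fun ω => if ω c = 0 then a else b) ω := by
  have h := R.mem_state_iff {c | ω c ≠ 0} c
  rw [← stateOf] at h
  unfold cellVal freeEvent
  by_cases hf : R.force c (R.stateOf ω ∩ Set.Iio c) <;> by_cases h0 : ω c = 0 <;>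
    simp_all [stateOf]

theorem cellVal_congr_inter_Iio {α : Type*} (a b e : α) {c d : C} (h : d < c) {σ τ : Set C}
    (hστ : σ ∩ Set.Iio c = τ ∩ Set.Iio c) : R.cellVal a b e d σ = R.cellVal a b e d τ := by
  have hmem : d ∈ σ ↔ d ∈ τ := by simpa [h] using Set.ext_iff.1 hστ d
  have hIio : σ ∩ Set.Iio d = τ ∩ Set.Iio d := by
    rw [← Set.inter_eq_right.2 (Set.Iio_subset_Iio h.le), ← Set.inter_assoc, hστ, Set.inter_assoc]
  rw [cellVal, cellVal, hIio]
  split_ifs <;> tauto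

theorem abs_cellVal_le (a b : ℝ) (c : C) (σ : Set C) :
    |R.cellVal a b 0 c σ| ≤ |a| + |b| := by
  unfold cellVal
  split_ifs
  · simpa only [abs_zero] using add_nonneg (abs_nonneg a) (abs_nonneg b)
  · exact le_add_of_nonneg_left (abs_nonneg a)
  · exact le_add_of_nonneg_right (abs_nonneg b)

theorem dartLaw_anti {U : Set (C → ℕ)} (hU : IsLowerSet U) (hUm : MeasurableSet U) {s t : ℝ}
    (hs : 0 ≤ s) (hst : s ≤ t) : R.dartLaw t U ≤ R.dartLaw s U := by
  -- The darts thrown up to time `s` and those thrown between `s` and `t`.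
  set κ : Measure (C → ℕ × ℕ) := Measure.infinitePi fun c =>
    (poissonMeasure (R.size c * s.toNNReal)).prod (poissonMeasure (R.size c * (t - s).toNNReal))
  have hκs : κ.map (fun ω c => (ω c).1) = R.dartLaw s := by
    rw [Measure.infinitePi_map_pi (f := fun _ (p : ℕ × ℕ) => p.1) _ fun _ => measurable_fst,
      dartLaw]
    congr
    funext c
    simp
  have hκt : κ.map (fun ω c => (ω c).1 + (ω c).2) = R.dartLaw t := by
    rw [Measure.infinitePi_map_pi (f := fun _ (p : ℕ × ℕ) => p.1 + p.2) _ fun _ => by fun_prop,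
      dartLaw]
    congr
    funext c
    have := poissonMeasure_conv_poissonMeasure (R.size c * s.toNNReal)
      (R.size c * (t - s).toNNReal)
    rw [Measure.conv, ← mul_add, ← Real.toNNReal_add hs (sub_nonneg.2 hst)] at this
    simpa using this
  rw [← hκs, ← hκt, Measure.map_apply (by fun_prop) hUm, Measure.map_apply (by fun_prop) hUm]
  exact measure_mono fun ω hω => hU (fun c => Nat.le_add_right _ _) hω

theorem isLowerSet_freeEvent (c : C) : IsLowerSet (R.freeEvent c) := by
  intro ω ω' hle hω hf
  refine hω (R.force_mono _ _ _ (Set.inter_subset_inter_left _ (R.state_mono ?_)) hf)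
  exact fun d hd => ((Nat.pos_of_ne_zero hd).trans_le (hle d)).ne'

theorem integral_ite_dartLaw {t : ℝ} (ht : 0 ≤ t) (c : C) (a b : ℝ) :
    ∫ ω, (if ω c = 0 then a else b) ∂(R.dartLaw t) =
      Real.exp (-(R.size c * t)) * a + (1 - Real.exp (-(R.size c * t))) * b := by
  rw [← R.coe_size_mul_toNNReal ht, ← integral_ite_poissonMeasure, ← Measure.infinitePi_map_eval
    (fun c => poissonMeasure (R.size c * t.toNNReal)) c, integral_map
    (measurable_pi_apply c).aemeasurable Measurable.of_discrete.aestronglyMeasurable]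
  rfl

variable {R} (hm : Measurable R.stateOf)

include hm

theorem measurableSet_freeEvent (c : C) : MeasurableSet (R.freeEvent c) := by
  have e : R.freeEvent c = {ω | c ∈ R.stateOf (({c}ᶜ : Set C).indicator ω)}ᶜ := by
    ext ω
    have h := R.force_iff_mem_state_sdiff (Function.support ω) c
    rw [Set.sdiff_eq, Set.inter_comm _ ({c}ᶜ), ← Set.support_indicator] at h
    exact not_congr h
  rw [e]
  exact (((measurable_set_mem c).comp hm).comp ((measurable_indicator_cylinderEvents _).mono
    cylinderEvents_le_pi le_rfl)).setOf.compl

theorem freeProb_anti (c : C) : AntitoneOn (R.freeProb c) (Set.Ici 0) := fun _ hs _ _ hst =>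
  ENNReal.toReal_mono (measure_ne_top _ _)
    (R.dartLaw_anti (R.isLowerSet_freeEvent c) (measurableSet_freeEvent hm c) hs hst)

theorem measurable_cellVal_stateOf (a b : ℝ) (c : C) :
    Measurable fun ω => R.cellVal a b 0 c (R.stateOf ω) := by
  simp only [R.cellVal_stateOf]
  refine Measurable.indicator ?_ (measurableSet_freeEvent hm c)
  exact (Measurable.of_discrete (f := fun n : ℕ => if n = 0 then a else b)).comp
    (measurable_pi_apply c)

theorem integrable_cellVal_stateOf (t : ℝ) (a b : ℝ) (c : C) :
    Integrable (fun ω => R.cellVal a b 0 c (R.stateOf ω)) (R.dartLaw t) :=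
  .of_bound (measurable_cellVal_stateOf hm a b c).aestronglyMeasurable (|a| + |b|)
    (.of_forall fun _ => R.abs_cellVal_le _ _ _ _)

theorem integral_mul_cellVal {t : ℝ} (ht : 0 ≤ t) (c : C) {g : (C → ℕ) → ℝ} (hg : Measurable g)
    (hgc : ∀ ω, g ((Set.Iio c).indicator ω) = g ω) (a b : ℝ) :
    ∫ ω, g ω * R.cellVal a b 0 c (R.stateOf ω) ∂(R.dartLaw t) =
      (∫ ω in R.freeEvent c, g ω ∂(R.dartLaw t)) *
        (Real.exp (-(R.size c * t)) * a + (1 - Real.exp (-(R.size c * t))) * b) := by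
  have hfm := measurableSet_freeEvent hm c
  have hind : IndepFun ((R.freeEvent c).indicator g) (fun ω => ω c) (R.dartLaw t) := by
    refine indepFun_eval_infinitePi _ (hg.indicator hfm) (S := Set.Iio c) (fun ω => ?_)
      (lt_irrefl c)
    by_cases h : ω ∈ R.freeEvent c
    · rw [Set.indicator_of_mem h, Set.indicator_of_mem ((R.indicator_Iio_mem_freeEvent ω c).2 h),
        hgc]
    · rw [Set.indicator_of_notMem h,
        Set.indicator_of_notMem (mt (R.indicator_Iio_mem_freeEvent ω c).1 h)]
  have hprod := hind.integral_fun_comp_mul_comp (f := id) (g := fun n => if n = 0 then a else b)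
    (hg.indicator hfm).aemeasurable (measurable_pi_apply c).aemeasurable
    measurable_id.aestronglyMeasurable Measurable.of_discrete.aestronglyMeasurable
  simp only [id] at hprod
  rw [← integral_indicator hfm, ← R.integral_ite_dartLaw ht c, ← hprod]
  refine integral_congr_ae (.of_forall fun ω => ?_)
  by_cases h : ω ∈ R.freeEvent c <;> simp [R.cellVal_stateOf, h]

theorem integral_cellVal {t : ℝ} (ht : 0 ≤ t) (c : C) (a b : ℝ) :
    ∫ ω, R.cellVal a b 0 c (R.stateOf ω) ∂(R.dartLaw t) =
      R.freeProb c t *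
        (Real.exp (-(R.size c * t)) * a + (1 - Real.exp (-(R.size c * t))) * b) := by
  simpa [freeProb] using
    integral_mul_cellVal hm ht c (g := fun _ => 1) measurable_const (fun _ => rfl) a b

end Forcing

end LinearRule

/-- The entropy, in nats, of the indicator of a cell expecting `x` darts. -/
noncomputable def cellEntropy (x : ℝ) : ℝ := bernoulliEntropy (Real.exp (-x))

/-- The normalized Fisher information of the cardinality with respect to the indicator of a cell
expecting `x` darts, that is, the information of the logarithm of the cardinality. -/
noncomputable def cellInfo (x : ℝ) : ℝ := x ^ 2 / (Real.exp x - 1)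

theorem cellEntropy_eq (x : ℝ) : cellEntropy x =
    Real.exp (-x) * x + (1 - Real.exp (-x)) * -Real.log (1 - Real.exp (-x)) := by
  rw [cellEntropy, bernoulliEntropy, Real.log_exp]
  ring

theorem cellInfo_nonneg {x : ℝ} (hx : 0 ≤ x) : 0 ≤ cellInfo x :=
  div_nonneg (sq_nonneg x) (sub_nonneg.2 (Real.one_le_exp hx))

theorem cellEntropy_nonneg {x : ℝ} (hx : 0 ≤ x) : 0 ≤ cellEntropy x := by
  have h1 : Real.exp (-x) ≤ 1 := Real.exp_le_one_iff.2 (neg_nonpos.2 hx)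
  have h2 : Real.log (1 - Real.exp (-x)) ≤ 0 :=
    Real.log_nonpos (sub_nonneg.2 h1) (sub_le_self 1 (Real.exp_pos _).le)
  rw [cellEntropy_eq]
  exact add_nonneg (by positivity) (mul_nonneg (sub_nonneg.2 h1) (neg_nonneg.2 h2))

theorem mean_score {p : ℝ} (hp : 0 ≤ p) {t : ℝ} (ht : 0 < t) :
    Real.exp (-(p * t)) * -p + (1 - Real.exp (-(p * t))) * (p / (Real.exp (p * t) - 1)) = 0 := by
  rcases hp.eq_or_lt with rfl | hp
  · simp
  have h1 : Real.exp (p * t) - 1 ≠ 0 := (sub_pos.2 (Real.one_lt_exp_iff.2 (by positivity))).ne'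
  rw [Real.exp_neg]
  field_simp
  ring

theorem variance_score {p : ℝ} (hp : 0 ≤ p) {t : ℝ} (ht : 0 < t) :
    Real.exp (-(p * t)) * (-p) ^ 2 +
      (1 - Real.exp (-(p * t))) * (p / (Real.exp (p * t) - 1)) ^ 2 = cellInfo (p * t) / t ^ 2 := by
  rcases hp.eq_or_lt with rfl | hp
  · simp [cellInfo]
  have h1 : Real.exp (p * t) - 1 ≠ 0 := (sub_pos.2 (Real.one_lt_exp_iff.2 (by positivity))).ne'
  rw [Real.exp_neg, cellInfo]
  field_simp
  ring

theorem log_one_sub_exp_neg_sub_le {x y : ℝ} (hx : 0 < x) (hy : 0 < y) :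
    Real.log (1 - Real.exp (-y)) - Real.log (1 - Real.exp (-x)) ≤
      (y - x) / (Real.exp x - 1) := by
  have hpos : ∀ z : ℝ, 0 < z → 0 < 1 - Real.exp (-z) := fun z hz =>
    sub_pos.2 (Real.exp_lt_one_iff.2 (neg_lt_zero.2 hz))
  have hexp : Real.exp (-x) * Real.exp x = 1 := by rw [← Real.exp_add]; simp
  have htan : Real.exp (-x) * (1 - (y - x)) ≤ Real.exp (-y) :=
    calc Real.exp (-x) * (1 - (y - x)) ≤ Real.exp (-x) * Real.exp (-(y - x)) := by
          gcongr
          exact Real.one_sub_le_exp_neg _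
      _ = Real.exp (-y) := by rw [← Real.exp_add]; ring_nf
  have hx1 : 0 < Real.exp x - 1 := sub_pos.2 (Real.one_lt_exp_iff.2 hx)
  calc Real.log (1 - Real.exp (-y)) - Real.log (1 - Real.exp (-x))
      = Real.log ((1 - Real.exp (-y)) / (1 - Real.exp (-x))) :=
        (Real.log_div (hpos y hy).ne' (hpos x hx).ne').symm
    _ ≤ (1 - Real.exp (-y)) / (1 - Real.exp (-x)) - 1 :=
        Real.log_le_sub_one_of_pos (div_pos (hpos y hy) (hpos x hx))
    _ = (Real.exp (-x) - Real.exp (-y)) / (1 - Real.exp (-x)) := by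
        rw [div_sub_one (hpos x hx).ne']
        ring
    _ ≤ Real.exp (-x) * (y - x) / (1 - Real.exp (-x)) := by
        gcongr
        · exact (hpos x hx).le
        · linarith
    _ = (y - x) / (Real.exp x - 1) := by
        rw [div_eq_div_iff (hpos x hx).ne' hx1.ne']
        linear_combination (y - x) * hexp

theorem tendsto_slope_of_tangent {ι : Type*} {l : Filter ι} {f : ℝ → ℝ} {t D : ℝ}
    (hf : HasDerivAt f D t) {g : ι → ℝ → ℝ} {d : ι → ℝ}
    (hlim : ∀ᶠ s in 𝓝 t, Tendsto (fun i => g i s) l (𝓝 (f s)))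
    (htan : ∀ᶠ s in 𝓝 t, ∀ i, g i s - g i t ≤ d i * (s - t)) :
    Tendsto d l (𝓝 D) := by
  have hs : Tendsto (slope f t) (𝓝[≠] t) (𝓝 D) := hf.tendsto_slope
  have hslope : ∀ᶠ s in 𝓝 t, (Tendsto (fun i => slope (g i) t s) l
      (𝓝 (slope f t s))) ∧ ∀ i, g i s - g i t ≤ d i * (s - t) := by
    filter_upwards [hlim, htan] with s hlims htans
    simp only [slope_def_field]
    exact ⟨(hlims.sub hlim.self_of_nhds).div_const _, htans⟩
  rw [tendsto_order]
  constructor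
  · intro a ha
    have hright : ∀ᶠ s in 𝓝[>] t, a < slope f t s :=
      (hs.mono_left (nhdsWithin_mono t fun s hs => ne_of_gt hs)).eventually (lt_mem_nhds ha)
    obtain ⟨s, ⟨has, hlims, htans⟩, hst⟩ :=
      ((hright.and (hslope.filter_mono nhdsWithin_le_nhds)).and self_mem_nhdsWithin).exists
    filter_upwards [hlims.eventually (lt_mem_nhds has)] with i hi
    refine hi.trans_le ?_
    rw [slope_def_field, div_le_iff₀ (sub_pos.2 hst)]
    exact htans i
  · intro a ha
    have hleft : ∀ᶠ s in 𝓝[<] t, slope f t s < a :=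
      (hs.mono_left (nhdsWithin_mono t fun s hs => ne_of_lt hs)).eventually (gt_mem_nhds ha)
    obtain ⟨s, ⟨has, hlims, htans⟩, hst⟩ :=
      ((hleft.and (hslope.filter_mono nhdsWithin_le_nhds)).and self_mem_nhdsWithin).exists
    filter_upwards [hlims.eventually (gt_mem_nhds has)] with i hi
    refine lt_of_le_of_lt ?_ hi
    rw [slope_def_field, le_div_iff_of_neg (sub_neg.2 hst)]
    exact htans i

namespace LinearRule

section Scores

variable {C : Type*} [LinearOrder C] (R : LinearRule C)

/-- The logarithmic derivative with respect to `t` of the probability of the content of `c`. -/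
noncomputable def cellScore (t : ℝ) (c : C) (σ : Set C) : ℝ :=
  R.cellVal (-(R.size c : ℝ)) (R.size c / (Real.exp (R.size c * t) - 1)) 0 c σ

theorem log_cellProb_sub_le {s t : ℝ} (hs : 0 < s) (ht : 0 < t) (c : C) (σ : Set C) :
    Real.log (R.cellProb s c σ) - Real.log (R.cellProb t c σ) ≤
      R.cellScore t c σ * (s - t) := by
  unfold cellProb cellScore cellVal
  split_ifs
  · simp
  · rcases (R.size c).coe_nonneg.eq_or_lt with h0 | hpos
    · simp [← h0]
    · refine (log_one_sub_exp_neg_sub_le (mul_pos hpos ht) (mul_pos hpos hs)).trans_eq ?_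
      ring
  · rw [Real.log_exp, Real.log_exp]
    exact le_of_eq (by ring)

theorem log_prod_cellProb {t : ℝ} (ht : 0 ≤ t) {σ : Set C} (F : Finset C)
    (hpos : 0 < (R.dartLaw t).real {ω | R.stateOf ω = σ}) :
    Real.log (∏ c ∈ F, R.cellProb t c σ) = ∑ c ∈ F, Real.log (R.cellProb t c σ) :=
  Real.log_prod fun c hc =>
    Finset.prod_ne_zero_iff.1 (hpos.trans_le (R.prob_le_prod_cellProb ht σ F)).ne' c hc

theorem neg_log_cellProb (t : ℝ) (c : C) (σ : Set C) : -Real.log (R.cellProb t c σ) =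
    R.cellVal (R.size c * t : ℝ) (-Real.log (1 - Real.exp (-(R.size c * t)))) 0 c σ := by
  rw [cellProb, R.apply_cellVal fun x => -Real.log x]
  simp

theorem neg_log_cellProb_nonneg {t : ℝ} (ht : 0 ≤ t) (c : C) (σ : Set C) :
    0 ≤ -Real.log (R.cellProb t c σ) := by
  have h : Real.exp (-(R.size c * t)) ≤ 1 := Real.exp_le_one_iff.2
    (neg_nonpos.2 (mul_nonneg (R.size c).coe_nonneg ht))
  refine neg_nonneg.2 (Real.log_nonpos ?_ ?_) <;> unfold cellProb cellVal <;> split_ifs <;>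
    linarith [Real.exp_pos (-(R.size c * t))]

variable {R} (hm : Measurable R.stateOf)

include hm

/- The derivative of the infinite product cannot be taken factor by factor, but the logarithm of
each factor lies below its tangents, so that difference quotients of the limit bound the partial
sums. -/
theorem tendsto_sum_cellScore [Countable C] {t : ℝ} (ht : 0 < t) {σ : Set C} {ψ : ℝ → ℝ}
    (hψ : ∀ s, 0 < s → ψ s = (R.dartLaw s).real {ω | R.stateOf ω = σ}) (hpos : 0 < ψ t)
    (hd : DifferentiableAt ℝ ψ t) :
    Tendsto (fun F : Finset C => ∑ c ∈ F, R.cellScore t c σ) atTop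
      (𝓝 (deriv ψ t / ψ t)) := by
  have h0 : ∀ᶠ s in 𝓝 t, 0 < s := lt_mem_nhds ht
  refine tendsto_slope_of_tangent (f := fun s => Real.log (ψ s))
    (g := fun F s => ∑ c ∈ F, Real.log (R.cellProb s c σ)) (hd.hasDerivAt.log hpos.ne') ?_ ?_
  · filter_upwards [h0, hd.continuousAt.eventually (lt_mem_nhds hpos)] with s hs hψs
    rw [hψ s hs] at hψs ⊢
    exact ((tendsto_prod_cellProb_prob hm hs.le hψs.ne').log hψs.ne').congr fun F =>
      R.log_prod_cellProb hs.le F hψs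
  · filter_upwards [h0] with s hs F
    rw [← Finset.sum_sub_distrib, Finset.sum_mul]
    exact Finset.sum_le_sum fun c _ => R.log_cellProb_sub_le hs ht c σ

theorem integral_cellScore_mul_of_lt {t : ℝ} (ht : 0 < t) {c d : C} (h : d < c) :
    ∫ ω, R.cellScore t d (R.stateOf ω) * R.cellScore t c (R.stateOf ω) ∂(R.dartLaw t) = 0 := by
  unfold cellScore
  rw [integral_mul_cellVal hm ht.le c (measurable_cellVal_stateOf hm _ _ d) (fun ω =>
    R.cellVal_congr_inter_Iio _ _ _ h (R.stateOf_indicator_Iio_inter ω c)),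
    mean_score (R.size c).coe_nonneg ht, mul_zero]

theorem integral_cellScore_sq {t : ℝ} (ht : 0 < t) (c : C) :
    ∫ ω, R.cellScore t c (R.stateOf ω) * R.cellScore t c (R.stateOf ω) ∂(R.dartLaw t) =
      R.freeProb c t * (cellInfo (R.size c * t) / t ^ 2) := by
  rw [← variance_score (R.size c).coe_nonneg ht, ← integral_cellVal hm ht.le]
  refine integral_congr_ae (.of_forall fun ω => ?_)
  simp only [cellScore, ← pow_two, R.apply_cellVal (fun x : ℝ => x ^ 2)]
  simp

theorem memLp_cellScore (t : ℝ) (c : C) :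
    MemLp (fun ω => R.cellScore t c (R.stateOf ω)) 2 (R.dartLaw t) :=
  .of_bound (measurable_cellVal_stateOf hm _ _ c).aestronglyMeasurable _
    (.of_forall fun _ => R.abs_cellVal_le _ _ _ _)

theorem integral_sum_cellScore_sq {t : ℝ} (ht : 0 < t) (F : Finset C) :
    ∫ ω, (∑ c ∈ F, R.cellScore t c (R.stateOf ω)) ^ 2 ∂(R.dartLaw t) =
      ∑ c ∈ F, R.freeProb c t * (cellInfo (R.size c * t) / t ^ 2) := by
  have hint : ∀ c d, Integrable
      (fun ω => R.cellScore t c (R.stateOf ω) * R.cellScore t d (R.stateOf ω)) (R.dartLaw t) :=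
    fun c d => (memLp_cellScore hm t c).integrable_mul (memLp_cellScore hm t d)
  simp only [pow_two, Finset.sum_mul_sum]
  rw [integral_finsetSum _ fun c _ => integrable_finsetSum _ fun d _ => hint c d]
  refine Finset.sum_congr rfl fun c hc => ?_
  rw [integral_finsetSum _ fun d _ => hint c d, Finset.sum_eq_single_of_mem c hc, ← pow_two]
  · exact integral_cellScore_sq hm ht c
  · intro d _ hdc
    rcases hdc.lt_or_gt with h | h
    · simp only [mul_comm (R.cellScore t c _)]
      exact integral_cellScore_mul_of_lt hm ht h
    · exact integral_cellScore_mul_of_lt hm ht h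

theorem lintegral_sum_cellScore_sq {t : ℝ} (ht : 0 < t) (F : Finset C) :
    ∫⁻ ω, ENNReal.ofReal ((∑ c ∈ F, R.cellScore t c (R.stateOf ω)) ^ 2) ∂(R.dartLaw t) =
      ∑ c ∈ F, ENNReal.ofReal (R.freeProb c t * (cellInfo (R.size c * t) / t ^ 2)) := by
  have hnn : ∀ c, 0 ≤ R.freeProb c t * (cellInfo (R.size c * t) / t ^ 2) := fun c =>
    mul_nonneg (R.freeProb_nonneg c t) (div_nonneg (cellInfo_nonneg (by positivity)) (sq_nonneg t))
  rw [← ofReal_integral_eq_lintegral_ofReal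
    (memLp_finsetSum F fun c _ => memLp_cellScore hm t c).integrable_sq
    (.of_forall fun _ => sq_nonneg _), integral_sum_cellScore_sq hm ht,
    ENNReal.ofReal_sum_of_nonneg fun c _ => hnn c]

theorem lintegral_neg_log_cellProb {t : ℝ} (ht : 0 ≤ t) (c : C) :
    ∫⁻ ω, ENNReal.ofReal (-Real.log (R.cellProb t c (R.stateOf ω))) ∂(R.dartLaw t) =
      ENNReal.ofReal (R.freeProb c t) * ENNReal.ofReal (cellEntropy (R.size c * t)) := by
  rw [← ENNReal.ofReal_mul (R.freeProb_nonneg c t), cellEntropy_eq, ← integral_cellVal hm ht,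
    ← ofReal_integral_eq_lintegral_ofReal _
      (.of_forall fun ω => R.neg_log_cellProb_nonneg ht c (R.stateOf ω))]
  · simp only [neg_log_cellProb]
  · simp only [neg_log_cellProb]
    exact integrable_cellVal_stateOf hm t _ _ c

end Scores

end LinearRule

/-- The states of the sketch `A` are identified, via `occ`, with sets of occupied cells in such a
way that `A` describes the dartboard with the rule `R`. -/
structure SketchIDF.IsRealizedBy {M C : Type*} [LinearOrder C] (A : SketchIDF M)
    (R : LinearRule C) (occ : M → Set C) : Prop where
  injective : Function.Injective occ
  measurable_stateOf : Measurable R.stateOf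
  prob_eq : ∀ t : ℝ, 0 < t → ∀ x, A.prob t x = (R.dartLaw t).real {ω | R.stateOf ω = occ x}

namespace SketchIDF

variable {M C : Type*} [Countable C] [LinearOrder C] {A : SketchIDF M} {R : LinearRule C}
  {occ : M → Set C}

namespace IsRealizedBy

theorem lintegral_stateOf (hA : A.IsRealizedBy R occ) {t : ℝ} (ht : 0 < t) (f : Set C → ℝ≥0∞) :
    ∫⁻ ω, f (R.stateOf ω) ∂(R.dartLaw t) = ∑' x, f (occ x) * ENNReal.ofReal (A.prob t x) := by
  set E : M → Set (C → ℕ) := fun x => {ω | R.stateOf ω = occ x}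
  set S : Set M := Function.support (A.prob t)
  have hS : S.Countable := (A.prob_hasSum t ht).summable.countable_support
  have hE : ∀ x, R.dartLaw t (E x) = ENNReal.ofReal (A.prob t x) := fun x => by
    rw [hA.prob_eq t ht x, ofReal_measureReal]
  have hEm : ∀ x, MeasurableSet (E x) := fun x =>
    LinearRule.measurableSet_stateOf_eq hA.measurable_stateOf (occ x)
  have hEd : S.PairwiseDisjoint E := fun x _ y _ hxy => Set.disjoint_left.2 fun ω hx hy =>
    hxy (hA.injective (hx.symm.trans hy))
  have hsum : ∀ g : M → ℝ≥0∞, ∑' x : S, g x * ENNReal.ofReal (A.prob t x) =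
      ∑' x, g x * ENNReal.ofReal (A.prob t x) := fun g =>
    tsum_subtype_eq_of_support_subset (f := fun x => g x * ENNReal.ofReal (A.prob t x))
      fun x hx h0 => hx (by simp [h0])
  have hone : R.dartLaw t (⋃ x ∈ S, E x) = 1 := by
    rw [measure_biUnion hS hEd fun x _ => hEm x]
    simp only [hE]
    have h1 := hsum fun _ => 1
    simp only [one_mul] at h1
    rw [h1, ← ENNReal.ofReal_tsum_of_nonneg (A.prob_nonneg t ht) (A.prob_hasSum t ht).summable,
      (A.prob_hasSum t ht).tsum_eq, ENNReal.ofReal_one]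
  have hae : ∀ᵐ ω ∂(R.dartLaw t), ω ∈ ⋃ x ∈ S, E x :=
    (mem_ae_iff_prob_eq_one (.biUnion hS fun x _ => hEm x)).2 hone
  rw [← Measure.restrict_eq_self_of_ae_mem hae, lintegral_biUnion hS (fun x _ => hEm x) hEd,
    ← hsum]
  refine tsum_congr fun x => ?_
  rw [setLIntegral_congr_fun (g := fun _ => f (occ x)) (hEm x) fun ω hω => congrArg f hω,
    setLIntegral_const, hE]

theorem tsum_freeProb_mul_cellEntropy_le (hA : A.IsRealizedBy R occ) {t : ℝ} (ht : 0 < t) :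
    ∑' c, ENNReal.ofReal (R.freeProb c t) * ENNReal.ofReal (cellEntropy (R.size c * t)) ≤
      ENNReal.ofReal (Real.log 2) * A.entropy t := by
  have hm := hA.measurable_stateOf
  have hmeas : ∀ c, Measurable fun ω =>
      ENNReal.ofReal (-Real.log (R.cellProb t c (R.stateOf ω))) := fun c => by
    simp only [R.neg_log_cellProb]
    exact (LinearRule.measurable_cellVal_stateOf hm _ _ c).ennreal_ofReal
  simp only [← LinearRule.lintegral_neg_log_cellProb hm ht.le]
  rw [ENNReal.tsum_eq_iSup_sum]
  refine iSup_le fun F => ?_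
  rw [← lintegral_finsetSum _ fun c _ => hmeas c, hA.lintegral_stateOf ht
    fun σ => ∑ c ∈ F, ENNReal.ofReal (-Real.log (R.cellProb t c σ)), entropy,
    ← ENNReal.tsum_mul_left]
  refine ENNReal.tsum_le_tsum fun x => ?_
  rcases (A.prob_nonneg t ht x).eq_or_lt with h0 | hpos
  · simp [← h0]
  have hle : ∑ c ∈ F, -Real.log (R.cellProb t c (occ x)) ≤ -Real.log (A.prob t x) := by
    rw [hA.prob_eq t ht x] at hpos ⊢
    rw [Finset.sum_neg_distrib, ← R.log_prod_cellProb ht.le F hpos]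
    exact neg_le_neg (Real.log_le_log hpos (R.prob_le_prod_cellProb ht.le _ F))
  rw [← ENNReal.ofReal_sum_of_nonneg fun c _ => R.neg_log_cellProb_nonneg ht.le c (occ x),
    ← ENNReal.ofReal_mul' hpos.le, ← ENNReal.ofReal_mul (Real.log_nonneg one_le_two)]
  refine ENNReal.ofReal_le_ofReal ((mul_le_mul_of_nonneg_right hle hpos.le).trans_eq ?_)
  rw [Real.logb]
  field_simp

theorem fisherInfo_le_tsum_freeProb (hA : A.IsRealizedBy R occ) {t : ℝ} (ht : 0 < t) :
    A.fisherInfo t ≤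
      ∑' c, ENNReal.ofReal (R.freeProb c t * (cellInfo (R.size c * t) / t ^ 2)) := by
  classical
  have hm := hA.measurable_stateOf
  rw [fisherInfo, ENNReal.tsum_eq_iSup_sum]
  refine iSup_le fun K => ?_
  rw [← Finset.sum_filter_of_ne (p := fun x => deriv (fun s => A.prob s x) t ≠ 0 ∧ A.prob t x ≠ 0)
    fun x _ hx => ⟨fun h => hx (by simp [h]), fun h => hx (by simp [h])⟩]
  set K' := K.filter fun x => deriv (fun s => A.prob s x) t ≠ 0 ∧ A.prob t x ≠ 0
  have hlim : Tendsto (fun F : Finset C => ∑ x ∈ K', ENNReal.ofReal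
      ((∑ c ∈ F, R.cellScore t c (occ x)) ^ 2 * A.prob t x)) atTop
      (𝓝 (∑ x ∈ K', ENNReal.ofReal
        ((deriv (fun s => A.prob s x) t / A.prob t x) ^ 2 * A.prob t x))) := by
    refine tendsto_finsetSum _ fun x hx => ENNReal.tendsto_ofReal ?_
    obtain ⟨_, hd, hp⟩ := Finset.mem_filter.1 hx
    have hscore := LinearRule.tendsto_sum_cellScore hm ht (fun s hs => hA.prob_eq s hs x)
      ((A.prob_nonneg t ht x).lt_of_ne' hp) (differentiableAt_of_deriv_ne_zero hd)
    exact (hscore.pow 2).mul_const _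
  refine le_of_tendsto' hlim fun F => ?_
  calc ∑ x ∈ K', ENNReal.ofReal ((∑ c ∈ F, R.cellScore t c (occ x)) ^ 2 * A.prob t x)
      ≤ ∑' x, ENNReal.ofReal ((∑ c ∈ F, R.cellScore t c (occ x)) ^ 2) *
          ENNReal.ofReal (A.prob t x) := by
        simp only [ENNReal.ofReal_mul (sq_nonneg _)]
        exact ENNReal.sum_le_tsum K'
    _ = ∑ c ∈ F, ENNReal.ofReal (R.freeProb c t * (cellInfo (R.size c * t) / t ^ 2)) := by
        rw [← hA.lintegral_stateOf ht
          fun σ => ENNReal.ofReal ((∑ c ∈ F, R.cellScore t c σ) ^ 2),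
          LinearRule.lintegral_sum_cellScore_sq hm ht]
    _ ≤ _ := ENNReal.sum_le_tsum F

theorem sq_mul_fisherInfo_le (hA : A.IsRealizedBy R occ) {t : ℝ} (ht : 0 < t) :
    ENNReal.ofReal (t ^ 2) * A.fisherInfo t ≤
      ∑' c, ENNReal.ofReal (R.freeProb c t) * ENNReal.ofReal (cellInfo (R.size c * t)) := by
  refine (mul_le_mul_right (hA.fisherInfo_le_tsum_freeProb ht) _).trans_eq ?_
  rw [← ENNReal.tsum_mul_left]
  refine tsum_congr fun c => ?_
  rw [← ENNReal.ofReal_mul (sq_nonneg t), ← ENNReal.ofReal_mul (R.freeProb_nonneg c t)]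
  congr 1
  field_simp

end IsRealizedBy

end SketchIDF

theorem neg_log_one_sub_le {v : ℝ} (h0 : 0 ≤ v) (h1 : v < 1) :
    -Real.log (1 - v) ≤ v * (2 - v) / (2 * (1 - v)) := by
  have hv : 0 < 1 - v := sub_pos.2 h1
  have h := Real.self_le_sinh_iff.2 (Real.log_nonneg ((one_le_inv₀ hv).2 (by linarith)))
  rw [Real.sinh_log (inv_pos.2 hv), Real.log_inv, inv_inv] at h
  refine h.trans_eq ?_
  field_simp
  ring

theorem neg_log_mul_le {x : ℝ} (hx : 0 < x) :
    -Real.log (1 - Real.exp (-x)) * (x * (1 + Real.exp (-x)) - 2 * (1 - Real.exp (-x))) ≤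
      x * Real.exp (-x) := by
  have hxv : x * Real.exp (-x) ≤ 1 - Real.exp (-x) := by
    have h := mul_le_mul_of_nonneg_right (Real.add_one_le_exp x) (Real.exp_pos (-x)).le
    rw [← Real.exp_add, add_neg_cancel, Real.exp_zero] at h
    linarith
  have hv0 : 0 < Real.exp (-x) := Real.exp_pos _
  have hv1 : Real.exp (-x) < 1 := Real.exp_lt_one_iff.2 (neg_lt_zero.2 hx)
  generalize Real.exp (-x) = v at hxv hv0 hv1 ⊢
  have hL0 : 0 ≤ -Real.log (1 - v) :=
    neg_nonneg.2 (Real.log_nonpos (by linarith) (by linarith))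
  rcases le_or_gt (x * (1 + v) - 2 * (1 - v)) 0 with h | h
  · exact (mul_nonpos_of_nonneg_of_nonpos hL0 h).trans (by positivity)
  · refine (mul_le_mul_of_nonneg_right (neg_log_one_sub_le hv0.le hv1) h.le).trans ?_
    rw [div_mul_eq_mul_div, div_le_iff₀ (by linarith)]
    have hmul : x * v * (3 - v) ≤ (1 - v) * (2 * (2 - v)) :=
      mul_le_mul hxv (by linarith) (by linarith) (by linarith)
    linear_combination v * hmul

theorem antitoneOn_one_sub_exp_neg_div :
    AntitoneOn (fun x : ℝ => (1 - Real.exp (-x)) / x) (Set.Ioi 0) := by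
  intro x hx y hy hxy
  have hconv : ConvexOn ℝ Set.univ fun x : ℝ => Real.exp (-x) :=
    convexOn_exp.comp_linearMap (-LinearMap.id)
  have h := hconv.secant_mono (Set.mem_univ 0) (Set.mem_univ x) (Set.mem_univ y)
    (ne_of_gt hx) (ne_of_gt hy) hxy
  simp only [neg_zero, Real.exp_zero, sub_zero] at h
  simp only [← neg_sub (Real.exp _) 1, neg_div]
  exact neg_le_neg h

theorem hasDerivAt_sq_mul_neg_log {x : ℝ} (hx : 0 < x) :
    HasDerivAt
      (fun x => (Real.exp x - 2 + Real.exp (-x)) * -Real.log (1 - Real.exp (-x)) / x ^ 2)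
      ((1 - Real.exp (-x)) / (Real.exp (-x) * x ^ 3) *
        (-Real.log (1 - Real.exp (-x)) * (x * (1 + Real.exp (-x)) - 2 * (1 - Real.exp (-x))) -
          x * Real.exp (-x))) x := by
  have hv : HasDerivAt (fun x => Real.exp (-x)) (-Real.exp (-x)) x := by
    simpa using (hasDerivAt_neg x).exp
  have hv1 : 1 - Real.exp (-x) ≠ 0 := (sub_pos.2 (Real.exp_lt_one_iff.2 (neg_lt_zero.2 hx))).ne'
  refine (((((Real.hasDerivAt_exp x).sub_const 2).add hv).mul
    ((hv.const_sub 1).log hv1).neg).div (hasDerivAt_pow 2 x) (by positivity)).congr_deriv ?_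
  simp only [Pi.add_apply, Pi.mul_apply, Pi.neg_apply]
  rw [show Real.exp x = (Real.exp (-x))⁻¹ by rw [Real.exp_neg, inv_inv]]
  generalize Real.log _ = L
  have hv0 : Real.exp (-x) ≠ 0 := (Real.exp_pos _).ne'
  generalize Real.exp (-x) = v at hv0 hv1 ⊢
  field_simp
  ring

theorem antitoneOn_sq_mul_neg_log :
    AntitoneOn (fun x : ℝ =>
      (Real.exp x - 2 + Real.exp (-x)) * -Real.log (1 - Real.exp (-x)) / x ^ 2) (Set.Ioi 0) := by
  refine antitoneOn_of_deriv_nonpos (convex_Ioi 0)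
    (fun x hx => (hasDerivAt_sq_mul_neg_log hx).continuousAt.continuousWithinAt) ?_ ?_ <;>
    rw [interior_Ioi] <;> intro x (hx : 0 < x)
  · exact (hasDerivAt_sq_mul_neg_log hx).differentiableAt.differentiableWithinAt
  · rw [(hasDerivAt_sq_mul_neg_log hx).deriv]
    have hv1 : 0 ≤ 1 - Real.exp (-x) := sub_nonneg.2 (Real.exp_le_one_iff.2 (neg_nonpos.2 hx.le))
    exact mul_nonpos_of_nonneg_of_nonpos (by positivity) (sub_nonpos.2 (neg_log_mul_le hx))

theorem cellEntropy_div_cellInfo {x : ℝ} (hx : 0 < x) : cellEntropy x / cellInfo x =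
    (1 - Real.exp (-x)) / x +
      (Real.exp x - 2 + Real.exp (-x)) * -Real.log (1 - Real.exp (-x)) / x ^ 2 := by
  rw [cellEntropy_eq, cellInfo]
  generalize Real.log _ = L
  rw [Real.exp_neg]
  field_simp
  ring

theorem cellInfo_pos {x : ℝ} (hx : 0 < x) : 0 < cellInfo x :=
  div_pos (by positivity) (sub_pos.2 (Real.one_lt_exp_iff.2 hx))

theorem antitoneOn_cellEntropy_div_cellInfo :
    AntitoneOn (fun x => cellEntropy x / cellInfo x) (Set.Ioi 0) :=
  (antitoneOn_one_sub_exp_neg_div.add antitoneOn_sq_mul_neg_log).congr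
    fun _ hx => (cellEntropy_div_cellInfo hx).symm

theorem cellEntropy_mul_cellInfo_le {x y : ℝ} (hx : 0 < x) (hxy : x ≤ y) :
    cellEntropy y * cellInfo x ≤ cellEntropy x * cellInfo y :=
  (div_le_div_iff₀ (cellInfo_pos (hx.trans_le hxy)) (cellInfo_pos hx)).1
    (antitoneOn_cellEntropy_div_cellInfo hx (hx.trans_le hxy) hxy)

theorem mul_add_mul_le_of_antitone {α : Type*} [LinearOrder α] {u f g : α → ℝ≥0∞}
    (hu : Antitone u) (h : ∀ x y, x ≤ y → f y * g x ≤ f x * g y) (x y : α) :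
    f x * (u y * g y) + u x * g x * f y ≤ u x * f x * g y + g x * (u y * f y) := by
  have hle : ∀ x y, x ≤ y →
      f x * (u y * g y) + u x * g x * f y ≤ u x * f x * g y + g x * (u y * f y) :=
    fun x y hxy => by
      obtain ⟨d, hd⟩ := exists_add_of_le (hu hxy)
      calc f x * (u y * g y) + u x * g x * f y
        _ = u y * (f x * g y + f y * g x) + d * (f y * g x) := by rw [hd]; ring
        _ ≤ u y * (f x * g y + f y * g x) + d * (f x * g y) := by gcongr _ + d * ?_; exact h x y hxy
        _ = u x * f x * g y + g x * (u y * f y) := by rw [hd]; ring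
  rcases le_total x y with hxy | hyx
  · exact hle x y hxy
  · calc
      _ = f y * (u x * g x) + u y * g y * f x := by ring
      _ ≤ u y * f y * g x + g y * (u x * f x) := hle y x hyx
      _ = _ := by ring

theorem lintegral_mul_lintegral_mul_le_of_antitone {α : Type*} [LinearOrder α] [MeasurableSpace α]
    {μ : Measure α} {u f g : α → ℝ≥0∞} (hu : Antitone u) (hum : Measurable u) (hf : Measurable f)
    (hg : Measurable g) (h : ∀ x y, x ≤ y → f y * g x ≤ f x * g y) :
    (∫⁻ x, f x ∂μ) * ∫⁻ x, u x * g x ∂μ ≤ (∫⁻ x, u x * f x ∂μ) * ∫⁻ x, g x ∂μ := by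
  have hug : Measurable fun x => u x * g x := hum.mul hg
  have huf : Measurable fun x => u x * f x := hum.mul hf
  have hdouble : (∫⁻ x, f x ∂μ) * (∫⁻ x, u x * g x ∂μ) + (∫⁻ x, u x * g x ∂μ) * ∫⁻ x, f x ∂μ ≤
      (∫⁻ x, u x * f x ∂μ) * (∫⁻ x, g x ∂μ) + (∫⁻ x, g x ∂μ) * ∫⁻ x, u x * f x ∂μ := by
    have hsum : ∀ φ ψ φ' ψ' : α → ℝ≥0∞, Measurable φ → Measurable ψ → Measurable φ' →
        Measurable ψ' → (∫⁻ x, φ x ∂μ) * (∫⁻ x, ψ x ∂μ) + (∫⁻ x, φ' x ∂μ) * ∫⁻ x, ψ' x ∂μ =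
          ∫⁻ x, ∫⁻ y, φ x * ψ y + φ' x * ψ' y ∂μ ∂μ := fun φ ψ φ' ψ' hφ hψ hφ' hψ' => by
      simp only [lintegral_add_left (hψ.const_mul _), lintegral_const_mul _ hψ,
        lintegral_const_mul _ hψ', lintegral_add_left (hφ.mul_const _), lintegral_mul_const _ hφ,
        lintegral_mul_const _ hφ']
    rw [hsum _ _ _ _ hf hug hug hf, hsum _ _ _ _ huf hg hg huf]
    exact lintegral_mono fun x => lintegral_mono fun y =>
      mul_add_mul_le_of_antitone hu h x y
  rw [mul_comm (∫⁻ x, u x * g x ∂μ), mul_comm (∫⁻ x, g x ∂μ), ← two_mul, ← two_mul] at hdouble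
  exact (ENNReal.mul_le_mul_iff_right two_ne_zero ENNReal.ofNat_ne_top).1 hdouble

/-- Lebesgue measure with the density `b ^ r`.  For `b > 1` it is finite on half-lines unbounded
below, so that periodic functions can be averaged over such half-lines. -/
noncomputable def geomMeasure (b : ℝ) : Measure ℝ :=
  volume.withDensity fun r => ENNReal.ofReal (b ^ r)

theorem lintegral_geomMeasure {b : ℝ} {f : ℝ → ℝ≥0∞} (hf : Measurable f) :
    ∫⁻ r, f r ∂geomMeasure b = ∫⁻ r, ENNReal.ofReal (b ^ r) * f r :=
  lintegral_withDensity_eq_lintegral_mul _ (by fun_prop) hf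

theorem map_add_right_geomMeasure {b : ℝ} (hb : 0 < b) (a : ℝ) :
    (geomMeasure b).map (· + a) = ENNReal.ofReal (b ^ (-a)) • geomMeasure b := by
  ext s hs
  have hdens : ∀ r, ENNReal.ofReal (b ^ r) =
      ENNReal.ofReal (b ^ (-a)) * ENNReal.ofReal (b ^ (r + a)) := by
    intro r
    rw [← ENNReal.ofReal_mul (by positivity), ← Real.rpow_add hb, neg_add_cancel_comm_assoc]
  rw [Measure.map_apply (measurable_add_const a) hs, Measure.smul_apply, geomMeasure,
    withDensity_apply _ (measurable_add_const a hs), withDensity_apply _ hs,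
    setLIntegral_congr_fun (measurable_add_const a hs) fun r _ => hdens r,
    lintegral_const_mul _ (by fun_prop), smul_eq_mul,
    (measurePreserving_add_right volume a).setLIntegral_comp_preimage hs
      (f := fun r => ENNReal.ofReal (b ^ r)) (by fun_prop)]

theorem lintegral_add_right_geomMeasure {b : ℝ} (hb : 0 < b) (f : ℝ → ℝ≥0∞) (a : ℝ) :
    ∫⁻ r, f (r + a) ∂geomMeasure b = ENNReal.ofReal (b ^ (-a)) * ∫⁻ r, f r ∂geomMeasure b := by
  rw [← (measurableEmbedding_addRight a).lintegral_map f, map_add_right_geomMeasure hb,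
    lintegral_smul_measure, smul_eq_mul]

theorem setLIntegral_Iic_geomMeasure {b : ℝ} (hb : 0 < b) {f : ℝ → ℝ≥0∞}
    (hf : Function.Periodic f 1) :
    ∫⁻ r in Set.Iic 1, f r ∂geomMeasure b =
      (∑' k : ℕ, ENNReal.ofReal b⁻¹ ^ k) * ∫⁻ r in Set.Ioc 0 1, f r ∂geomMeasure b := by
  have hunion : Set.Iic (1 : ℝ) = ⋃ k : ℕ, (· + (k : ℝ)) ⁻¹' Set.Ioc 0 1 := by
    ext r
    simp only [Set.mem_Iic, Set.mem_iUnion, Set.mem_preimage, Set.mem_Ioc]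
    refine ⟨fun hr => ⟨⌊1 - r⌋₊, ?_, ?_⟩, fun ⟨k, hk⟩ => by linarith [k.cast_nonneg (α := ℝ)]⟩
    · linarith [Nat.lt_floor_add_one (1 - r)]
    · linarith [Nat.floor_le (sub_nonneg.2 hr)]
  have hmeas : ∀ k : ℕ, MeasurableSet ((· + (k : ℝ)) ⁻¹' Set.Ioc (0 : ℝ) 1) := fun k =>
    measurable_add_const _ measurableSet_Ioc
  have hdisj : Pairwise
      (Function.onFun Disjoint fun k : ℕ => (· + (k : ℝ)) ⁻¹' Set.Ioc (0 : ℝ) 1) :=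
    fun k l hkl => Set.disjoint_left.2 fun r hk hl => hkl <| by
      have h1 : (k : ℝ) < l + 1 := by linarith [hk.2, hl.1]
      have h2 : (l : ℝ) < k + 1 := by linarith [hl.2, hk.1]
      norm_cast at h1 h2
      omega
  rw [hunion, lintegral_iUnion hmeas hdisj, ← ENNReal.tsum_mul_right]
  refine tsum_congr fun k => ?_
  have hshift := lintegral_add_right_geomMeasure hb ((Set.Ioc (0 : ℝ) 1).indicator f) k
  rw [Real.rpow_neg hb.le, Real.rpow_natCast, ← inv_pow, ENNReal.ofReal_pow (by positivity),
    lintegral_indicator measurableSet_Ioc] at hshift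
  rw [← hshift, ← lintegral_indicator (hmeas k)]
  refine lintegral_congr fun r => ?_
  have hperiodic : f (r + k) = f r := by simpa using hf.nat_mul k r
  rw [← Set.indicator_comp_right (g := f) (· + (k : ℝ))]
  simp only [Set.indicator, Function.comp_apply, hperiodic]

theorem setLIntegral_Ioc_le_geomMeasure {b : ℝ} (hb : 1 ≤ b) (f : ℝ → ℝ≥0∞) :
    ∫⁻ r in Set.Ioc 0 1, f r ≤ ∫⁻ r in Set.Ioc 0 1, f r ∂geomMeasure b := by
  refine lintegral_mono' ?_ le_rfl
  rw [geomMeasure, restrict_withDensity measurableSet_Ioc]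
  conv_lhs => rw [← withDensity_one (μ := volume.restrict (Set.Ioc (0 : ℝ) 1))]
  refine withDensity_mono ((ae_restrict_mem measurableSet_Ioc).mono fun r hr => ?_)
  exact ENNReal.one_le_ofReal.2 (Real.one_le_rpow hb hr.1.le)

theorem setLIntegral_geomMeasure_Ioc_le {b : ℝ} (hb : 1 ≤ b) (f : ℝ → ℝ≥0∞) :
    ∫⁻ r in Set.Ioc 0 1, f r ∂geomMeasure b ≤ ENNReal.ofReal b * ∫⁻ r in Set.Ioc 0 1, f r := by
  rw [← smul_eq_mul, ← lintegral_smul_measure]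
  refine lintegral_mono' ?_ le_rfl
  rw [geomMeasure, restrict_withDensity measurableSet_Ioc, ← withDensity_const]
  refine withDensity_mono ((ae_restrict_mem measurableSet_Ioc).mono fun r hr => ?_)
  exact ENNReal.ofReal_le_ofReal (Real.rpow_le_self_of_one_le hb hr.2)

theorem mul_setLIntegral_Icc_le_of_Iic {b : ℝ} (hb : 1 < b) {f g : ℝ → ℝ≥0∞}
    (hf : Function.Periodic f 1) (hg : Function.Periodic g 1) {α β : ℝ≥0∞}
    (h : α * ∫⁻ r in Set.Iic 1, f r ∂geomMeasure b ≤
      β * ∫⁻ r in Set.Iic 1, g r ∂geomMeasure b) :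
    α * ∫⁻ r in Set.Icc 0 1, f r ≤ ENNReal.ofReal b * β * ∫⁻ r in Set.Icc 0 1, g r := by
  have hb0 := zero_lt_one.trans hb
  have hS0 : ∑' k : ℕ, ENNReal.ofReal b⁻¹ ^ k ≠ 0 := fun h0 => by
    simpa using ENNReal.tsum_eq_zero.1 h0 0
  have hS : ∑' k : ℕ, ENNReal.ofReal b⁻¹ ^ k ≠ ∞ := by
    rw [ENNReal.tsum_geometric, ENNReal.inv_ne_top]
    exact (tsub_pos_of_lt (ENNReal.ofReal_lt_one.2 (inv_lt_one_of_one_lt₀ hb))).ne'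
  rw [setLIntegral_Iic_geomMeasure hb0 hf, setLIntegral_Iic_geomMeasure hb0 hg, mul_left_comm,
    mul_left_comm β, ENNReal.mul_le_mul_iff_right hS0 hS] at h
  simp only [← Measure.restrict_congr_set (Ioc_ae_eq_Icc (μ := volume) (a := (0 : ℝ)) (b := 1))]
  calc α * ∫⁻ r in Set.Ioc 0 1, f r
      ≤ α * ∫⁻ r in Set.Ioc 0 1, f r ∂geomMeasure b :=
        mul_le_mul_right (setLIntegral_Ioc_le_geomMeasure hb.le f) _
    _ ≤ β * ∫⁻ r in Set.Ioc 0 1, g r ∂geomMeasure b := h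
    _ ≤ β * (ENNReal.ofReal b * ∫⁻ r in Set.Ioc 0 1, g r) :=
        mul_le_mul_right (setLIntegral_geomMeasure_Ioc_le hb.le g) _
    _ = ENNReal.ofReal b * β * ∫⁻ r in Set.Ioc 0 1, g r := by ring

theorem rpow_le_one_add_rpow {b q : ℝ} (hb : 1 ≤ b) (hbq : b ≤ q) (r : ℝ) : b ^ r ≤ 1 + q ^ r := by
  have hb0 := zero_le_one.trans hb
  rcases le_total 0 r with hr | hr
  · exact (Real.rpow_le_rpow hb0 hbq hr).trans (le_add_of_nonneg_left zero_le_one)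
  · exact (Real.rpow_le_one_of_one_le_of_nonpos hb hr).trans
      (le_add_of_nonneg_right (Real.rpow_nonneg (hb0.trans hbq) r))

theorem lintegral_le_mul_of_geomMeasure {q : ℝ} (hq : 1 < q) {f g : ℝ → ℝ≥0∞} (hf : Measurable f)
    (hg : Measurable g) (hfin : ∫⁻ r, ENNReal.ofReal (1 + q ^ r) * g r ≠ ∞) {κ : ℝ≥0∞} (hκ : κ ≠ ∞)
    (h : ∀ b ∈ Set.Ioo 1 q,
      ∫⁻ r, f r ∂geomMeasure b ≤ ENNReal.ofReal b * κ * ∫⁻ r, g r ∂geomMeasure b) :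
    ∫⁻ r, f r ≤ κ * ∫⁻ r, g r := by
  obtain ⟨b, -, hb, hlim⟩ := exists_seq_strictAnti_tendsto' hq
  have hpow : ∀ r : ℝ, Tendsto (fun n => ENNReal.ofReal (b n ^ r)) atTop (𝓝 1) :=
    fun r => by
      simpa using ENNReal.tendsto_ofReal (hlim.rpow_const (p := r) (.inl one_ne_zero))
  have hmeas : ∀ {φ : ℝ → ℝ≥0∞}, Measurable φ → ∀ n, Measurable fun r =>
      ENNReal.ofReal (b n ^ r) * φ r := fun hφ n => by fun_prop
  have hN : Tendsto (fun n => ∫⁻ r, ENNReal.ofReal (b n ^ r) * g r) atTop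
      (𝓝 (∫⁻ r, g r)) := by
    refine tendsto_lintegral_of_dominated_convergence _ (hmeas hg) (fun n => .of_forall fun r => ?_)
      hfin (ae_of_all _ fun r => ?_)
    · exact mul_le_mul_left (ENNReal.ofReal_le_ofReal
        (rpow_le_one_add_rpow (hb n).1.le (hb n).2.le r)) _
    · simpa using ENNReal.Tendsto.mul_const (hpow r) (.inl one_ne_zero)
  have hfin' : ∫⁻ r, g r ≠ ∞ := ne_top_of_le_ne_top hfin <| lintegral_mono fun r =>
    le_mul_of_one_le_left' (ENNReal.one_le_ofReal.2 (le_add_of_nonneg_right (by positivity)))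
  have hbound : Tendsto
      (fun n => ENNReal.ofReal (b n) * κ * ∫⁻ r, ENNReal.ofReal (b n ^ r) * g r) atTop
      (𝓝 (κ * ∫⁻ r, g r)) := by
    simpa using ENNReal.Tendsto.mul (ENNReal.Tendsto.mul_const (ENNReal.tendsto_ofReal hlim)
      (.inr hκ)) (.inr hfin') hN (.inr (by simpa using hκ))
  calc ∫⁻ r, f r = ∫⁻ r, liminf (fun n => ENNReal.ofReal (b n ^ r) * f r) atTop := by
        refine lintegral_congr fun r => (Tendsto.liminf_eq ?_).symm
        simpa using ENNReal.Tendsto.mul_const (hpow r) (.inl one_ne_zero)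
    _ ≤ liminf (fun n => ∫⁻ r, ENNReal.ofReal (b n ^ r) * f r) atTop :=
        lintegral_liminf_le (hmeas hf)
    _ ≤ liminf (fun n => ENNReal.ofReal (b n) * κ * ∫⁻ r, ENNReal.ofReal (b n ^ r) * g r)
          atTop := by
        refine liminf_le_liminf (.of_forall fun n => ?_)
        simpa only [lintegral_geomMeasure hf, lintegral_geomMeasure hg] using h (b n) (hb n)
    _ = κ * ∫⁻ r, g r := hbound.liminf_eq

theorem measurable_cellEntropy : Measurable cellEntropy := by
  unfold cellEntropy bernoulliEntropy
  fun_prop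

theorem measurable_cellInfo : Measurable cellInfo := by
  unfold cellInfo
  fun_prop

theorem lintegral_cellEntropy_mul_lintegral_cellInfo_le {q b : ℝ} (hq : 1 < q) (hb : 0 < b)
    {u : ℝ → ℝ≥0∞} (hu : Antitone u) {p : ℝ} (hp : 0 ≤ p) :
    (∫⁻ r, ENNReal.ofReal (cellEntropy (q ^ r)) ∂geomMeasure b) *
        ∫⁻ r, u r * ENNReal.ofReal (cellInfo (p * q ^ r)) ∂geomMeasure b ≤
      (∫⁻ r, ENNReal.ofReal (cellInfo (q ^ r)) ∂geomMeasure b) *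
        ∫⁻ r, u r * ENNReal.ofReal (cellEntropy (p * q ^ r)) ∂geomMeasure b := by
  rcases hp.eq_or_lt with rfl | hp
  · simp [cellInfo]
  have hq0 := zero_lt_one.trans hq
  have hmono : ∀ x y : ℝ, x ≤ y → ENNReal.ofReal (cellEntropy (p * q ^ y)) *
      ENNReal.ofReal (cellInfo (p * q ^ x)) ≤ ENNReal.ofReal (cellEntropy (p * q ^ x)) *
      ENNReal.ofReal (cellInfo (p * q ^ y)) := fun x y hxy => by
    have hx : 0 < p * q ^ x := by positivity
    have hle : p * q ^ x ≤ p * q ^ y := by gcongr; exact hq.le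
    rw [← ENNReal.ofReal_mul (cellEntropy_nonneg (hx.le.trans hle)),
      ← ENNReal.ofReal_mul (cellEntropy_nonneg hx.le)]
    exact ENNReal.ofReal_le_ofReal (cellEntropy_mul_cellInfo_le hx hle)
  -- A cell of size `p` differs from one of size `1` by a shift of the logarithmic time.
  have hshift : ∀ φ : ℝ → ℝ≥0∞, ∫⁻ r, φ (p * q ^ r) ∂geomMeasure b =
      ENNReal.ofReal (b ^ (-Real.logb q p)) * ∫⁻ r, φ (q ^ r) ∂geomMeasure b := fun φ => by
    rw [← lintegral_add_right_geomMeasure hb fun r => φ (q ^ r)]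
    simp only [Real.rpow_add hq0, Real.rpow_logb hq0 hq.ne' hp, mul_comm]
  have hcheb := lintegral_mul_lintegral_mul_le_of_antitone (μ := geomMeasure b)
    (f := fun r => ENNReal.ofReal (cellEntropy (p * q ^ r)))
    (g := fun r => ENNReal.ofReal (cellInfo (p * q ^ r))) hu hu.measurable
    (measurable_cellEntropy.comp (by fun_prop)).ennreal_ofReal
    (measurable_cellInfo.comp (by fun_prop)).ennreal_ofReal hmono
  rw [hshift fun x => ENNReal.ofReal (cellEntropy x), hshift fun x => ENNReal.ofReal (cellInfo x),
    mul_left_comm _ (ENNReal.ofReal (b ^ _)), mul_assoc, mul_comm (∫⁻ r, u r * _ ∂_)] at hcheb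
  exact (ENNReal.mul_le_mul_iff_right (ENNReal.ofReal_pos.2 (by positivity)).ne'
    ENNReal.ofReal_ne_top).1 hcheb

namespace LinearRule

variable {C : Type*} [LinearOrder C] {R : LinearRule C}

theorem antitone_indicator_freeProb (hm : Measurable R.stateOf) {q : ℝ} (hq : 1 ≤ q) (c : C) :
    Antitone ((Set.Iic 1).indicator fun r : ℝ => ENNReal.ofReal (R.freeProb c (q ^ r))) := by
  have hq0 := zero_lt_one.trans_le hq
  intro r s hrs
  by_cases hs : s ∈ Set.Iic (1 : ℝ)
  · rw [Set.indicator_of_mem hs, Set.indicator_of_mem (Set.mem_Iic.2 (hrs.trans hs))]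
    exact ENNReal.ofReal_le_ofReal (freeProb_anti hm c (Real.rpow_nonneg hq0.le r)
      (Real.rpow_nonneg hq0.le s) (Real.rpow_le_rpow_of_exponent_le hq hrs))
  · simp [Set.indicator_of_notMem hs]

theorem lintegral_cellEntropy_mul_lintegral_tsum_le [Countable C]
    (hm : Measurable R.stateOf) {q b : ℝ} (hq : 1 < q) (hb : 0 < b) :
    (∫⁻ r, ENNReal.ofReal (cellEntropy (q ^ r)) ∂geomMeasure b) *
        (∫⁻ r in Set.Iic 1, ∑' c, ENNReal.ofReal (R.freeProb c (q ^ r)) *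
          ENNReal.ofReal (cellInfo (R.size c * q ^ r)) ∂geomMeasure b) ≤
      (∫⁻ r, ENNReal.ofReal (cellInfo (q ^ r)) ∂geomMeasure b) *
        ∫⁻ r in Set.Iic 1, ∑' c, ENNReal.ofReal (R.freeProb c (q ^ r)) *
          ENNReal.ofReal (cellEntropy (R.size c * q ^ r)) ∂geomMeasure b := by
  set u : C → ℝ → ℝ≥0∞ := fun c =>
    (Set.Iic 1).indicator fun r => ENNReal.ofReal (R.freeProb c (q ^ r))
  have hu : ∀ c, Antitone (u c) := antitone_indicator_freeProb hm hq.le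
  have hsum : ∀ φ : ℝ → ℝ, Measurable φ →
      ∫⁻ r in Set.Iic 1, ∑' c, ENNReal.ofReal (R.freeProb c (q ^ r)) *
        ENNReal.ofReal (φ (R.size c * q ^ r)) ∂geomMeasure b =
      ∑' c, ∫⁻ r, u c r * ENNReal.ofReal (φ (R.size c * q ^ r)) ∂geomMeasure b := fun φ hφ => by
    have hmeas : ∀ c, Measurable fun r =>
        u c r * ENNReal.ofReal (φ (R.size c * q ^ r)) := fun c =>
      (hu c).measurable.mul (hφ.comp (by fun_prop)).ennreal_ofReal
    rw [← lintegral_indicator measurableSet_Iic, ← lintegral_tsum fun c => (hmeas c).aemeasurable]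
    refine lintegral_congr fun r => ?_
    by_cases hr : r ∈ Set.Iic 1 <;> simp only [u, Set.indicator, hr, if_true, if_false, zero_mul,
      tsum_zero]
  rw [hsum _ measurable_cellInfo, hsum _ measurable_cellEntropy, ← ENNReal.tsum_mul_left,
    ← ENNReal.tsum_mul_left]
  exact ENNReal.tsum_le_tsum fun c =>
    lintegral_cellEntropy_mul_lintegral_cellInfo_le hq hb (hu c) (R.size c).coe_nonneg

end LinearRule

namespace SketchIDF

variable {M C : Type*} [Countable C] [LinearOrder C] {A : SketchIDF M} {R : LinearRule C}
  {occ : M → Set C} {q : ℝ}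

theorem WeaklyScaleInvariant.periodic_entropy (h : A.WeaklyScaleInvariant q) :
    Function.Periodic (fun r : ℝ => A.entropy (q ^ r)) 1 := fun r => by
  have hq0 := zero_lt_one.trans h.1
  simp only [(h.2 (q ^ r) (by positivity)).1, Real.rpow_add hq0, Real.rpow_one, mul_comm]

theorem WeaklyScaleInvariant.periodic_fisherInfo (h : A.WeaklyScaleInvariant q) :
    Function.Periodic (fun r : ℝ => ENNReal.ofReal (q ^ (2 * r)) * A.fisherInfo (q ^ r)) 1 :=
  fun r => by
    have hq0 := zero_lt_one.trans h.1
    have hsq : q ^ (2 * (r + 1)) = q ^ (2 * r) * q ^ 2 := by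
      rw [mul_add, Real.rpow_add hq0, mul_one, Real.rpow_two]
    simp only [(h.2 (q ^ r) (by positivity)).2, hsq, Real.rpow_add hq0, Real.rpow_one, mul_comm q,
      ENNReal.ofReal_mul (Real.rpow_nonneg hq0.le (2 * r)), mul_assoc]

theorem IsRealizedBy.lintegral_cellEntropy_mul_avgInfo_le (hA : A.IsRealizedBy R occ)
    (h : A.WeaklyScaleInvariant q) {b : ℝ} (hb : 1 < b) :
    (∫⁻ r, ENNReal.ofReal (cellEntropy (q ^ r)) ∂geomMeasure b) * A.avgInfo q ≤
      ENNReal.ofReal b * (∫⁻ r, ENNReal.ofReal (cellInfo (q ^ r)) ∂geomMeasure b) *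
        (ENNReal.ofReal (Real.log 2) * A.avgEntropy q) := by
  have hq0 := zero_lt_one.trans h.1
  rw [avgEntropy, ← lintegral_const_mul' (ENNReal.ofReal (Real.log 2)) _ ENNReal.ofReal_ne_top]
  have hinfo : ∀ r : ℝ, ENNReal.ofReal (q ^ (2 * r)) * A.fisherInfo (q ^ r) ≤
      ∑' c, ENNReal.ofReal (R.freeProb c (q ^ r)) *
        ENNReal.ofReal (cellInfo (R.size c * q ^ r)) := fun r => by
    rw [mul_comm 2 r, Real.rpow_mul hq0.le, Real.rpow_two]
    exact hA.sq_mul_fisherInfo_le (Real.rpow_pos_of_pos hq0 r)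
  have hentropy : ∀ r : ℝ, ∑' c, ENNReal.ofReal (R.freeProb c (q ^ r)) *
      ENNReal.ofReal (cellEntropy (R.size c * q ^ r)) ≤
        ENNReal.ofReal (Real.log 2) * A.entropy (q ^ r) := fun r =>
    hA.tsum_freeProb_mul_cellEntropy_le (Real.rpow_pos_of_pos hq0 r)
  refine mul_setLIntegral_Icc_le_of_Iic hb h.periodic_fisherInfo
    (h.periodic_entropy.comp (ENNReal.ofReal (Real.log 2) * ·)) ?_
  exact (mul_le_mul_right (lintegral_mono hinfo) _).trans
    ((LinearRule.lintegral_cellEntropy_mul_lintegral_tsum_le hA.measurable_stateOf h.1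
      (zero_lt_one.trans hb)).trans (mul_le_mul_right (lintegral_mono hentropy) _))

end SketchIDF

theorem one_add_exp_mul_cellInfo_exp_le_of_nonpos {w : ℝ} (hw : w ≤ 0) :
    (1 + Real.exp w) * cellInfo (Real.exp w) ≤ 2 * Real.exp w := by
  have hx := Real.exp_pos w
  have hinfo : cellInfo (Real.exp w) ≤ Real.exp w := by
    rw [cellInfo, div_le_iff₀ (sub_pos.2 (Real.one_lt_exp_iff.2 hx)), sq]
    exact mul_le_mul_of_nonneg_left (le_sub_iff_add_le.2 (Real.add_one_le_exp _)) hx.le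
  exact mul_le_mul (by linarith [Real.exp_le_one_iff.2 hw]) hinfo (cellInfo_pos hx).le two_pos.le

theorem one_add_exp_mul_cellInfo_exp_le_of_nonneg {w : ℝ} (hw : 0 ≤ w) :
    (1 + Real.exp w) * cellInfo (Real.exp w) ≤ 48 * Real.exp (-w) := by
  rw [Real.exp_neg]
  have hx1 := Real.one_le_exp hw
  generalize Real.exp w = x at hx1 ⊢
  have hexp : x ^ 4 / 24 ≤ Real.exp x - 1 := by
    have h := Real.sum_le_exp_of_nonneg (zero_le_one.trans hx1) 5
    simp only [Finset.sum_range_succ, Finset.sum_range_zero, Nat.factorial] at h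
    norm_num at h
    nlinarith [pow_pos (zero_lt_one.trans_le hx1) 2, pow_pos (zero_lt_one.trans_le hx1) 3]
  calc (1 + x) * cellInfo x ≤ 2 * x * (x ^ 2 / (x ^ 4 / 24)) := by
        rw [cellInfo]
        have hx : 0 < x ^ 4 / 24 := by positivity
        exact mul_le_mul (by linarith) (by gcongr) (by have := hx.trans_le hexp; positivity)
          (by linarith)
    _ = 48 * x⁻¹ := by field_simp; norm_num

theorem integrable_one_add_exp_mul_cellInfo_exp :
    Integrable fun w => (1 + Real.exp w) * cellInfo (Real.exp w) := by
  have hmeas : Measurable fun w => (1 + Real.exp w) * cellInfo (Real.exp w) :=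
    (by fun_prop : Measurable fun w => 1 + Real.exp w).mul
      (measurable_cellInfo.comp Real.measurable_exp)
  have hnorm : ∀ w, ‖(1 + Real.exp w) * cellInfo (Real.exp w)‖ =
      (1 + Real.exp w) * cellInfo (Real.exp w) := fun w =>
    Real.norm_of_nonneg (mul_nonneg (by positivity) (cellInfo_pos (Real.exp_pos w)).le)
  rw [← integrableOn_univ, ← Set.Iic_union_Ioi (a := (0 : ℝ)), integrableOn_union]
  constructor
  · refine ((integrableOn_exp_Iic 0).const_mul 2).mono' hmeas.aestronglyMeasurable
      ((ae_restrict_mem measurableSet_Iic).mono fun w hw => ?_)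
    exact (hnorm w).trans_le (one_add_exp_mul_cellInfo_exp_le_of_nonpos hw)
  · refine ((integrableOn_exp_neg_Ioi 0).const_mul 48).mono' hmeas.aestronglyMeasurable
      ((ae_restrict_mem measurableSet_Ioi).mono fun w hw => ?_)
    exact (hnorm w).trans_le (one_add_exp_mul_cellInfo_exp_le_of_nonneg (Set.mem_Ioi.1 hw).le)

section

variable {q : ℝ}

theorem measurable_ofReal_cellInfo_rpow (q : ℝ) :
    Measurable fun r : ℝ => ENNReal.ofReal (cellInfo (q ^ r)) :=
  (measurable_cellInfo.comp (by fun_prop)).ennreal_ofReal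

theorem integrable_one_add_rpow_mul_cellInfo (hq : 1 < q) :
    Integrable fun r : ℝ => (1 + q ^ r) * cellInfo (q ^ r) := by
  simpa only [← Real.rpow_def_of_pos (zero_lt_one.trans hq)] using
    integrable_one_add_exp_mul_cellInfo_exp.comp_mul_left' (Real.log_pos hq).ne'

theorem lintegral_one_add_rpow_mul_cellInfo_ne_top (hq : 1 < q) :
    ∫⁻ r : ℝ, ENNReal.ofReal (1 + q ^ r) * ENNReal.ofReal (cellInfo (q ^ r)) ≠ ∞ := by
  refine ne_of_eq_of_ne (lintegral_congr fun r => ?_)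
    (integrable_one_add_rpow_mul_cellInfo hq).lintegral_lt_top.ne
  rw [← ENNReal.ofReal_mul (by positivity)]

theorem lintegral_cellInfo_geomMeasure_ne_top {b : ℝ} (hb : b ∈ Set.Ioo 1 q) :
    ∫⁻ r, ENNReal.ofReal (cellInfo (q ^ r)) ∂geomMeasure b ≠ ∞ := by
  rw [lintegral_geomMeasure (measurable_ofReal_cellInfo_rpow q)]
  exact ne_top_of_le_ne_top (lintegral_one_add_rpow_mul_cellInfo_ne_top (hb.1.trans hb.2))
    (lintegral_mono fun r =>
      mul_le_mul_left (ENNReal.ofReal_le_ofReal (rpow_le_one_add_rpow hb.1.le hb.2.le r)) _)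

theorem lintegral_cellInfo_geomMeasure_ne_zero (hq : 0 < q) {b : ℝ} (hb : 0 < b) :
    ∫⁻ r, ENNReal.ofReal (cellInfo (q ^ r)) ∂geomMeasure b ≠ 0 := by
  have hmeas := measurable_ofReal_cellInfo_rpow q
  rw [lintegral_geomMeasure hmeas, Ne, lintegral_eq_zero_iff (by fun_prop)]
  intro h
  obtain ⟨r, hr⟩ := h.exists
  exact mul_ne_zero (ENNReal.ofReal_pos.2 (Real.rpow_pos_of_pos hb r)).ne'
    (ENNReal.ofReal_pos.2 (cellInfo_pos (Real.rpow_pos_of_pos hq r))).ne' hr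

theorem integral_comp_exp (hq : 1 < q) (φ : ℝ → ℝ) :
    ∫ w, φ (Real.exp w) = Real.log q * ∫ r : ℝ, φ (q ^ r) := by
  have hlog := Real.log_pos hq
  simp only [Real.rpow_def_of_pos (zero_lt_one.trans hq)]
  rw [Measure.integral_comp_mul_left (fun w => φ (Real.exp w)), abs_of_pos (inv_pos.2 hlog),
    smul_eq_mul, mul_inv_cancel_left₀ hlog.ne']

theorem integrable_cellInfo_rpow (hq : 1 < q) : Integrable fun r : ℝ => cellInfo (q ^ r) := by
  have hq0 := zero_lt_one.trans hq
  refine (integrable_one_add_rpow_mul_cellInfo hq).mono'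
    (measurable_cellInfo.comp (by fun_prop)).aestronglyMeasurable (ae_of_all _ fun r => ?_)
  have hinfo := cellInfo_nonneg (Real.rpow_nonneg hq0.le r)
  rw [Real.norm_of_nonneg hinfo]
  exact le_mul_of_one_le_left hinfo (le_add_of_nonneg_right (by positivity))

theorem ofReal_constI0 (hq : 1 < q) : ENNReal.ofReal constI0 =
    ENNReal.ofReal (Real.log q) * ∫⁻ r : ℝ, ENNReal.ofReal (cellInfo (q ^ r)) := by
  rw [show constI0 = ∫ w, cellInfo (Real.exp w) from rfl, integral_comp_exp hq,
    ENNReal.ofReal_mul (Real.log_pos hq).le, ofReal_integral_eq_lintegral_ofReal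
      (integrable_cellInfo_rpow hq) (ae_of_all _ fun r => cellInfo_nonneg (by positivity))]

theorem constI0_pos : 0 < constI0 := by
  have hint : Integrable fun w => cellInfo (Real.exp w) := by
    simpa only [Real.exp_one_rpow] using integrable_cellInfo_rpow (Real.one_lt_exp_iff.2 one_pos)
  have hsupp : Function.support (fun w => cellInfo (Real.exp w)) = Set.univ :=
    Set.eq_univ_of_forall fun w => (cellInfo_pos (Real.exp_pos w)).ne'
  exact (integral_pos_iff_support_of_nonneg (fun w => cellInfo_nonneg (Real.exp_pos w).le) hint).2
    (by simp [hsupp])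

theorem ofReal_log_two_mul_ofReal_constH0_le (hq : 1 < q) :
    ENNReal.ofReal (Real.log 2) * ENNReal.ofReal constH0 ≤
      ENNReal.ofReal (Real.log q) * ∫⁻ r : ℝ, ENNReal.ofReal (cellEntropy (q ^ r)) := by
  have hlog := Real.log_pos one_lt_two
  have hnonneg : ∀ r : ℝ, 0 ≤ cellEntropy (q ^ r) := fun r =>
    cellEntropy_nonneg (Real.rpow_nonneg (zero_lt_one.trans hq).le r)
  rw [← ENNReal.ofReal_mul hlog.le, show constH0 = 1 / Real.log 2 * ∫ w, cellEntropy (Real.exp w)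
    from rfl, integral_comp_exp hq, ← mul_assoc, mul_one_div_cancel hlog.ne', one_mul,
    ENNReal.ofReal_mul (Real.log_pos hq).le]
  refine mul_le_mul_right ?_ _
  rw [integral_eq_lintegral_of_nonneg_ae (ae_of_all _ hnonneg)
    (measurable_cellEntropy.comp (by fun_prop)).aestronglyMeasurable]
  exact ENNReal.ofReal_toReal_le

end

namespace SketchIDF

variable {M C : Type*} [Countable C] [LinearOrder C] {A : SketchIDF M} {R : LinearRule C}
  {occ : M → Set C} {q : ℝ}

theorem IsRealizedBy.lintegral_cellEntropy_geomMeasure_le (hA : A.IsRealizedBy R occ)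
    (h : A.WeaklyScaleInvariant q) (hzero : ¬ (A.avgEntropy q = 0 ∧ A.avgInfo q = 0))
    (htop : ¬ (A.avgEntropy q = ∞ ∧ A.avgInfo q = ∞)) {b : ℝ} (hb : b ∈ Set.Ioo 1 q) :
    ∫⁻ r, ENNReal.ofReal (cellEntropy (q ^ r)) ∂geomMeasure b ≤
      ENNReal.ofReal b * (ENNReal.ofReal (Real.log 2) * A.fish q) *
        ∫⁻ r, ENNReal.ofReal (cellInfo (q ^ r)) ∂geomMeasure b := by
  have hle := hA.lintegral_cellEntropy_mul_avgInfo_le h hb.1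
  have hN0 :=
    lintegral_cellInfo_geomMeasure_ne_zero (zero_lt_one.trans h.1) (zero_lt_one.trans hb.1)
  have hN := lintegral_cellInfo_geomMeasure_ne_top hb
  have hlog : ENNReal.ofReal (Real.log 2) ≠ 0 :=
    (ENNReal.ofReal_pos.2 (Real.log_pos one_lt_two)).ne'
  have hb0 : ENNReal.ofReal b ≠ 0 := (ENNReal.ofReal_pos.2 (zero_lt_one.trans hb.1)).ne'
  rw [← ENNReal.le_div_iff_mul_le] at hle
  · refine hle.trans_eq ?_
    rw [fish, div_eq_mul_inv, div_eq_mul_inv]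
    ring
  · refine (em (A.avgInfo q = 0)).symm.imp_right fun hI => ?_
    exact mul_ne_zero (mul_ne_zero hb0 hN0) (mul_ne_zero hlog fun hH => hzero ⟨hH, hI⟩)
  · refine (em (A.avgInfo q = ∞)).symm.imp_right fun hI => ?_
    exact ENNReal.mul_ne_top (ENNReal.mul_ne_top ENNReal.ofReal_ne_top hN)
      (ENNReal.mul_ne_top ENNReal.ofReal_ne_top fun hH => htop ⟨hH, hI⟩)

theorem IsRealizedBy.lintegral_cellEntropy_le (hA : A.IsRealizedBy R occ)
    (h : A.WeaklyScaleInvariant q) (hzero : ¬ (A.avgEntropy q = 0 ∧ A.avgInfo q = 0))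
    (htop : ¬ (A.avgEntropy q = ∞ ∧ A.avgInfo q = ∞)) (hfish : A.fish q ≠ ∞) :
    ∫⁻ r : ℝ, ENNReal.ofReal (cellEntropy (q ^ r)) ≤
      ENNReal.ofReal (Real.log 2) * A.fish q * ∫⁻ r : ℝ, ENNReal.ofReal (cellInfo (q ^ r)) :=
  lintegral_le_mul_of_geomMeasure h.1 (measurable_cellEntropy.comp (by fun_prop)).ennreal_ofReal
    (measurable_ofReal_cellInfo_rpow q)
    (lintegral_one_add_rpow_mul_cellInfo_ne_top h.1)
    (ENNReal.mul_ne_top ENNReal.ofReal_ne_top hfish)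
    fun _ hb => hA.lintegral_cellEntropy_geomMeasure_le h hzero htop hb

end SketchIDF

theorem corollary5p6_general {M : Type*} (A : SketchIDF M) (q : ℝ)
    (hlin : A.Linearizable) (hinv : A.WeaklyScaleInvariant q)
    (hzero : ¬ (A.avgEntropy q = 0 ∧ A.avgInfo q = 0))
    (htop : ¬ (A.avgEntropy q = ∞ ∧ A.avgInfo q = ∞)) :
    ENNReal.ofReal (constH0 / constI0) ≤ A.fish q := by
  obtain ⟨C, _, _, R, occ, hinj, hmeas, hprob⟩ := hlin
  have hA : A.IsRealizedBy R occ := ⟨hinj, hmeas, hprob⟩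
  rcases eq_or_ne (A.fish q) ∞ with hfish | hfish
  · exact hfish.ge.trans' le_top
  rw [ENNReal.ofReal_div_of_pos constI0_pos]
  refine ENNReal.div_le_of_le_mul ?_
  rw [← ENNReal.mul_le_mul_iff_right (ENNReal.ofReal_pos.2 (Real.log_pos one_lt_two)).ne'
    ENNReal.ofReal_ne_top]
  calc ENNReal.ofReal (Real.log 2) * ENNReal.ofReal constH0
      ≤ ENNReal.ofReal (Real.log q) * ∫⁻ r : ℝ, ENNReal.ofReal (cellEntropy (q ^ r)) :=
        ofReal_log_two_mul_ofReal_constH0_le hinv.1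
    _ ≤ ENNReal.ofReal (Real.log q) * (ENNReal.ofReal (Real.log 2) * A.fish q *
          ∫⁻ r : ℝ, ENNReal.ofReal (cellInfo (q ^ r))) :=
        mul_le_mul_right (hA.lintegral_cellEntropy_le hinv hzero htop hfish) _
    _ = ENNReal.ofReal (Real.log 2) * (A.fish q * ENNReal.ofReal constI0) := by
        rw [ofReal_constI0 hinv.1]
        ring

theorem corollary5p6 {M : Type*} [Countable M] (A : SketchIDF M) (q : ℝ)
    (hlin : A.Linearizable) (hinv : A.WeaklyScaleInvariant q)
    (hzero : ¬ (A.avgEntropy q = 0 ∧ A.avgInfo q = 0))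
    (htop : ¬ (A.avgEntropy q = ∞ ∧ A.avgInfo q = ∞)) :
    ENNReal.ofReal (constH0 / constI0) ≤ A.fish q :=
  corollary5p6_general A q hlin hinv hzero htop
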